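/- **Setting.** Small-cell base stations (SBSs) form a homogeneous Poisson point process in the plane of density $\lambda_{\rm S}>0$; the typical user (UE) is at the origin and is associated with the SBS $o$ of largest average received power $P_{\rm a}\beta|X|^{-\alpha_{\rm a}}$ ($P_{\rm a},\beta>0$, $\alpha_{\rm a}>2$). Independently at every SBS a content $j\in\{1,\dots,J\}$ is requested with Zipf probability $a_j=j^{-\varsigma}/\sum_{m=1}^J m^{-\varsigma}$, and content $j$ is cached, independently of the request, with probability $q_j\in[0,1]$; $q_{\rm hit}=\sum_j a_jq_j<1$. The channels from the SBSs to the typical UE have i.i.d. $\exp(1)$ power gains $h_i$, independent of everything else. Let $\Phi_{\rm S}^{\rm b}$ be the set of SBSs that have not cached the content requested from them. Let $K$ be the number of UEs in the cell of the typical UE (which is included), independent of the locations, fading, requests and caches. Its law is the usual gamma approximation of Poisson–Voronoi cells: with $\gamma=3.5$, the area of this cell has the area-weighted gamma law of shape $\gamma$ and unweighted mean $1/\lambda_{\rm S}$, and, given the area $a$, $K-1$ is Poisson with mean $\lambda_{\rm U}a$, where $\lambda_{\rm U}>0$ is the UE density. Let $Q>0$ be the number of bits to deliver, $W>0$ the bandwidth,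 $\eta\in(0,1)$, $T_{\rm th}$ the time threshold and $\epsilon\in(0,1)$. A content that is not cached at $o$ is first fetched from a macro base station (MBS) with $N$ antennas, transmit power $P_{\rm b}>0$ and $S_o$ served SBSs, $1\le S_o\le N$, MBS density $\lambda_{\rm M}>0$, path loss exponent $\alpha_{\rm b}>2$, noise power $\sigma_{\rm b}^2\ge0$ and minimum distance $r_{\rm b}\ge0$, in time $T_1=Q/\overline R_{\rm b}<T_{\rm th}$, where $$\overline R_{\rm b}=(1-\eta)W\int_{r_{\rm b}}^\infty\log_2\Big(1+\frac{\frac{P_{\rm b}}{S_o}\Xi_1(y)}{\frac{P_{\rm b}}{S_o}\Xi_2(y)+\Xi_3(y)+\sigma_{\rm b}^2}\Big)\frac{2\pi\lambda_{\rm M}ye^{-\pi\lambda_{\rm M}y^2}}{e^{-\pi\lambda_{\rm M}r_{\rm b}^2}}\,dy,$$ $\Xi_1(y)=\beta y^{-\alpha_{\rm b}}\big(\Gamma(N-S_o+\frac32)/\Gamma(N-S_o+1)\big)^2$, $\Xi_2(y)=(N-S_o+1)\beta y^{-\alpha_{\rm b}}-\Xi_1(y)$, $\Xi_3(y)=2\pi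 P_{\rm b}\lambda_{\rm M}\beta\,y^{2-\alpha_{\rm b}}/(\alpha_{\rm b}-2)$. In the interference-limited regime (noise at the UE neglected) the rate of the access link that follows is $$R_{{\rm a}'}=\frac{(1-\eta)W}{K}\log_2\Big(1+\frac{P_{\rm a}h_o\beta|X_o|^{-\alpha_{\rm a}}}{\sum_{i\in\Phi_{\rm S}^{\rm b}\setminus\{o\}}P_{\rm a}h_i\beta|X_i|^{-\alpha_{\rm a}}}\Big).$$ For $k\ge1$ let $\Lambda_k=\Pr\big(R_{{\rm a}'}>\frac{Q}{T_{\rm th}-T_1}\,\big|\,o\in\Phi_{\rm S}^{\rm b},\,K=k\big)$. Successful content delivery (SCD) occurs when $\Lambda_K\ge\epsilon$; let $\Psi_{\rm SCD}^{\rm b}=\Pr(\Lambda_K\ge\epsilon\mid o\in\Phi_{\rm S}^{\rm b})$ and let $K_{\max}^{\rm b}$ be the largest $k\ge1$ with $\Lambda_k\ge\epsilon$ ($0$ if there is none). **Theorem 2.** The interference is almost surely finite and positive, and the following hold. (i) For $k\ge1$, $\Pr(K=k)=\mathcal P_{\lambda_{\rm U}/\lambda_{\rm S}}(k)$, where $\mathcal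 P_x(k)=\frac{\gamma^\gamma}{(k-1)!}\frac{\Gamma(k+\gamma)}{\Gamma(\gamma)}\frac{x^{k-1}}{(\gamma+x)^{k+\gamma}}$, and $$\Psi_{\rm SCD}^{\rm b}=\sum_{k=1}^{K_{\max}^{\rm b}}\mathcal P_{\lambda_{\rm U}/\lambda_{\rm S}}(k).$$ (ii) The equation $$\frac{2^{\frac{\kappa Q}{(1-\eta)W(T_{\rm th}-T_1)}+1}-2}{\alpha_{\rm a}-2}\;{}_2F_1\Big[1,\tfrac{\alpha_{\rm a}-2}{\alpha_{\rm a}};\tfrac{2\alpha_{\rm a}-2}{\alpha_{\rm a}};1-2^{\frac{\kappa Q}{(1-\eta)W(T_{\rm th}-T_1)}}\Big]=\frac{1-\epsilon}{(1-q_{\rm hit})\epsilon}$$ has exactly one real solution $\kappa$; it is positive, $K_{\max}^{\rm b}=\lfloor\kappa\rfloor$, and $\Lambda_k\ge\epsilon$ exactly for $1\le k\le K_{\max}^{\rm b}$. (iii) Let $\rho>0$. Call an SBS density $\lambda>0$ overload-free if, for all $k>K_{\max}^{\rm b}$, $\mathcal P_{\lambda_{\rm U}/\lambda}(k)\le\rho$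 and $\mathcal P_{\lambda_{\rm U}/\lambda}(k+1)\le\mathcal P_{\lambda_{\rm U}/\lambda}(k)$. If $\mathcal P_{K_{\max}^{\rm b}+1}(K_{\max}^{\rm b}+1)\le\rho$, the minimum overload-free density is $\lambda_{\rm U}/(K_{\max}^{\rm b}+1)$. If $\mathcal P_{K_{\max}^{\rm b}+1}(K_{\max}^{\rm b}+1)>\rho$ and $K_{\max}^{\rm b}\ge1$, it is $\lambda_{\rm U}/\mu$, where $\mu$ is the unique solution of $\mathcal P_\mu(K_{\max}^{\rm b}+1)=\rho$ in $\big(0,\frac{K_{\max}^{\rm b}\gamma}{\gamma+1}\big]$. -/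

import Mathlib

open MeasureTheory ProbabilityTheory Set
open scoped ENNReal Function

namespace SelfBackhaul

noncomputable section

/-! ### Gauss hypergeometric function -/

/-- The Gauss hypergeometric function `₂F₁[a, b; c; z]` on the real half line `z < 1`, for
`0 < b < c`, given by Euler's integral (the analytic continuation of the hypergeometric series,
which itself converges for `|z| < 1` only). -/
def gauss2F1 (a b c z : ℝ) : ℝ :=
  Real.Gamma c / (Real.Gamma b * Real.Gamma (c - b)) *
    ∫ t in (0 : ℝ)..1, t ^ (b - 1) * (1 - t) ^ (c - b - 1) * (1 - z * t) ^ (-a)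

/-- Sanity check: in the family of parameters used below, and inside the disc of convergence,
`gauss2F1` is the sum of the hypergeometric series. -/
theorem gauss2F1_eq_ordinaryHypergeometric {b z : ℝ} (hb : 0 < b) (hz : |z| < 1) :
    gauss2F1 1 b (b + 1) z = ordinaryHypergeometric (𝕂 := ℝ) 1 b (b + 1) z := by
  have asc : ∀ n : ℕ, (ascPochhammer ℝ n).eval (b + 1) * b = (ascPochhammer ℝ n).eval b * (b + n) := by
    intro n
    induction n with
    | zero => simp
    | succ n ih =>
      rw [ascPochhammer_succ_eval, ascPochhammer_succ_eval]
      push_cast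
      linear_combination (b + 1 + n) * ih
  have key : HasSum (fun n : ℕ => z ^ n * (b + n)⁻¹)
      (∫ t in (0 : ℝ)..1, t ^ (b - 1) * (1 - z * t)⁻¹) := by
    have h := intervalIntegral.hasSum_integral_of_dominated_convergence (μ := volume)
      (a := (0 : ℝ)) (b := 1) (F := fun (n : ℕ) t => t ^ (b - 1) * (z * t) ^ n)
      (f := fun t => t ^ (b - 1) * (1 - z * t)⁻¹)
      (fun n t => t ^ (b - 1) * |z| ^ n) ?_ ?_ ?_ ?_ ?_
    · have e : (fun n : ℕ => z ^ n * (b + n)⁻¹) =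
          fun n : ℕ => ∫ t in (0 : ℝ)..1, t ^ (b - 1) * (z * t) ^ n := ?_
      · rw [e]
        exact h
      funext n
      have h1 : ∫ t in (0 : ℝ)..1, t ^ (b - 1) * (z * t) ^ n =
          ∫ t in (0 : ℝ)..1, z ^ n * t ^ (b - 1 + n) := by
        refine intervalIntegral.integral_congr_ae (Filter.Eventually.of_forall fun t ht => ?_)
        rw [uIoc_of_le zero_le_one] at ht
        rw [mul_pow, Real.rpow_add ht.1, Real.rpow_natCast]
        ring
      have hn : (0 : ℝ) ≤ n := n.cast_nonneg
      rw [h1, intervalIntegral.integral_const_mul, integral_rpow (Or.inl (by linarith))]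
      have h2 : b - 1 + (n : ℝ) + 1 = b + n := by ring
      rw [h2, Real.zero_rpow (by linarith)]
      simp
    · intro n
      exact (by fun_prop : Measurable fun t : ℝ => t ^ (b - 1) * (z * t) ^ n).aestronglyMeasurable
    · refine fun n => Filter.Eventually.of_forall fun t ht => ?_
      rw [uIoc_of_le zero_le_one] at ht
      rw [norm_mul, norm_pow, Real.norm_of_nonneg (Real.rpow_nonneg ht.1.le _), norm_mul,
        Real.norm_eq_abs, Real.norm_of_nonneg ht.1.le]
      refine mul_le_mul_of_nonneg_left (pow_le_pow_left₀ (by have := ht.1; positivity) ?_ _)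
        (Real.rpow_nonneg ht.1.le _)
      exact mul_le_of_le_one_right (abs_nonneg z) ht.2
    · exact Filter.Eventually.of_forall fun t _ =>
        (summable_geometric_of_lt_one (abs_nonneg z) hz).mul_left _
    · simp_rw [tsum_mul_left]
      exact (intervalIntegral.intervalIntegrable_rpow' (by linarith)).mul_const _
    · refine Filter.Eventually.of_forall fun t ht => ?_
      rw [uIoc_of_le zero_le_one] at ht
      refine (hasSum_geometric_of_abs_lt_one ?_).mul_left _
      rw [abs_mul, abs_of_pos ht.1]
      exact lt_of_le_of_lt (mul_le_of_le_one_right (abs_nonneg z) ht.2) hz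
  have hG : Real.Gamma b ≠ 0 := (Real.Gamma_pos_of_pos hb).ne'
  have hc : b + 1 - b = 1 := by ring
  rw [ordinaryHypergeometric_eq_tsum, gauss2F1, hc, Real.Gamma_one, Real.Gamma_add_one hb.ne',
    mul_one, mul_div_cancel_right₀ _ hG]
  simp only [sub_self, Real.rpow_zero, mul_one, Real.rpow_neg_one, smul_eq_mul]
  rw [← key.tsum_eq, ← tsum_mul_left]
  refine tsum_congr fun n => ?_
  have hp : (ascPochhammer ℝ n).eval (b + 1) ≠ 0 := (ascPochhammer_pos n _ (by linarith)).ne'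
  have hbn : b + (n : ℝ) ≠ 0 := by positivity
  have hf : ((n.factorial : ℕ) : ℝ) ≠ 0 := by positivity
  rw [ascPochhammer_eval_one]
  field_simp
  linear_combination z ^ n * asc n

/-! ### Poisson point processes in the plane -/

/-- The Euclidean plane. -/
abbrev Plane : Type := EuclideanSpace ℝ (Fin 2)

/-- Number of points of the configuration `X 0, X 1, …` that lie in `B`. -/
def pointCount {Ω : Type*} (X : ℕ → Ω → Plane) (B : Set Plane) (ω : Ω) : ℕ∞ :=
  {i : ℕ | X i ω ∈ B}.encard

/-- The enumerated random points `X 0, X 1, …` form a homogeneous Poisson point process of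
density `lam` in the plane: the number of points in a bounded Borel set `B` is Poisson
distributed with mean `lam * area B`, and the numbers of points in finitely many pairwise
disjoint bounded Borel sets are independent. -/
structure IsHPPP {Ω : Type*} [MeasurableSpace Ω] (μ : Measure Ω) (X : ℕ → Ω → Plane)
    (lam : ℝ) : Prop where
  measurable : ∀ i, Measurable (X i)
  count_law : ∀ B : Set Plane, MeasurableSet B → Bornology.IsBounded B → ∀ n : ℕ,
    μ {ω | pointCount X B ω = n} =
      ENNReal.ofReal (Real.exp (-(lam * volume.real B)) * (lam * volume.real B) ^ n
        / (n.factorial : ℝ))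
  indep : ∀ (m : ℕ) (B : Fin m → Set Plane), (∀ j, MeasurableSet (B j)) →
    (∀ j, Bornology.IsBounded (B j)) → Pairwise (Disjoint on B) →
    iIndepFun (fun j => pointCount X (B j)) μ

/-! ### System parameters -/

/-- Deterministic parameters of the network. -/
structure Params where
  /-- density of the user equipments (UEs) -/
  lamU : ℝ
  /-- density of the small-cell base stations (SBSs) -/
  lamS : ℝ
  /-- density of the macro base stations (MBSs) -/
  lamM : ℝ
  /-- number of contents in the library -/
  J : ℕ
  /-- Zipf exponent -/
  zipfExp : ℝ
  /-- probability that an SBS caches a given content -/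
  cacheProb : Fin J → ℝ
  /-- system bandwidth -/
  W : ℝ
  /-- fraction of the bandwidth that is given to the delivery of cached contents -/
  eta : ℝ
  /-- transmit power of an SBS -/
  Pa : ℝ
  /-- transmit power of an MBS -/
  Pb : ℝ
  /-- frequency dependent constant of the path loss -/
  beta : ℝ
  /-- path loss exponent of the access links -/
  alphaA : ℝ
  /-- path loss exponent of the backhaul links -/
  alphaB : ℝ
  /-- number of antennas of an MBS -/
  N : ℕ
  /-- number of SBSs served by the typical MBS -/
  So : ℕ
  /-- noise power at the typical SBS (backhaul link) -/
  noiseB : ℝ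
  /-- minimum distance between the typical MBS and its associated SBS -/
  rb : ℝ
  /-- number of bits of a content -/
  Q : ℝ
  /-- delivery time threshold -/
  Tth : ℝ
  /-- threshold on the conditional delivery probability -/
  eps : ℝ
  lamU_pos : 0 < lamU
  lamS_pos : 0 < lamS
  lamM_pos : 0 < lamM
  cacheProb_nonneg : ∀ j, 0 ≤ cacheProb j
  cacheProb_le_one : ∀ j, cacheProb j ≤ 1
  W_pos : 0 < W
  eta_pos : 0 < eta
  eta_lt_one : eta < 1
  Pa_pos : 0 < Pa
  Pb_pos : 0 < Pb
  beta_pos : 0 < beta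
  two_lt_alphaA : 2 < alphaA
  two_lt_alphaB : 2 < alphaB
  So_pos : 0 < So
  So_le_N : So ≤ N
  noiseB_nonneg : 0 ≤ noiseB
  rb_nonneg : 0 ≤ rb
  Q_pos : 0 < Q
  eps_pos : 0 < eps
  eps_lt_one : eps < 1

namespace Params

variable (p : Params)

/-- Zipf request probability of the `(j+1)`-st most popular content. -/
def zipf (j : Fin p.J) : ℝ :=
  ((j : ℝ) + 1) ^ (-p.zipfExp) / ∑ m : Fin p.J, ((m : ℝ) + 1) ^ (-p.zipfExp)

/-- Hit probability `q_hit = ∑ j, a_j q_j`. -/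
def qHit : ℝ := ∑ j, p.zipf j * p.cacheProb j

/-! ### Massive MIMO backhaul time -/

/-- Path loss of a backhaul link of length `y`. -/
def backhaulLoss (y : ℝ) : ℝ := p.beta * y ^ (-p.alphaB)

/-- Squared mean of the effective channel amplitude, times the path loss. -/
def Xi1 (y : ℝ) : ℝ :=
  p.backhaulLoss y *
    (Real.Gamma ((p.N : ℝ) - p.So + 3 / 2) / Real.Gamma ((p.N : ℝ) - p.So + 1)) ^ 2

/-- Variance of the effective channel amplitude, times the path loss. -/
def Xi2 (y : ℝ) : ℝ := ((p.N : ℝ) - p.So + 1) * p.backhaulLoss y - p.Xi1 y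

/-- Mean interference from the other MBSs. -/
def Xi3 (y : ℝ) : ℝ :=
  p.Pb * 2 * Real.pi * p.lamM * p.beta * (y ^ (2 - p.alphaB) / (p.alphaB - 2))

/-- Spectral efficiency of a backhaul link of length `y`. -/
def Cb (y : ℝ) : ℝ :=
  Real.logb 2 (1 + p.Pb / p.So * p.Xi1 y / (p.Pb / p.So * p.Xi2 y + p.Xi3 y + p.noiseB))

/-- Achievable rate of the typical backhaul link. -/
def backhaulRate : ℝ :=
  (1 - p.eta) * p.W * ∫ y in Ioi p.rb,
    p.Cb y * (2 * Real.pi * p.lamM * y * Real.exp (-(Real.pi * p.lamM * y ^ 2))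
      / Real.exp (-(Real.pi * p.lamM * p.rb ^ 2)))

/-- The time `T₁` for delivering the `Q` bits to the typical SBS via the backhaul. -/
def T1 : ℝ := p.Q / p.backhaulRate

/-! ### The equation for the maximum load -/

/-- `χ^b(k)`. -/
def chiB (k : ℝ) : ℝ :=
  gauss2F1 1 ((p.alphaA - 2) / p.alphaA) ((2 * p.alphaA - 2) / p.alphaA)
    (1 - 2 ^ (k * p.Q / ((1 - p.eta) * p.W * (p.Tth - p.T1))))

/-- `k` solves the equation that determines the maximum load. -/
def SolvesLoadEquation (k : ℝ) : Prop :=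
  (2 ^ (k * p.Q / ((1 - p.eta) * p.W * (p.Tth - p.T1)) + 1) - 2) / (p.alphaA - 2) * p.chiB k
    = (1 - p.eps) / ((1 - p.qHit) * p.eps)

end Params

/-! ### The load of a small cell -/

/-- Shape parameter of the (gamma distributed) area of a Poisson-Voronoi cell. -/
def shape : ℝ := 7 / 2

/-- Law of the area of the cell that contains the typical UE, for SBSs of density `lamS`: the
area-weighted version of the gamma law with shape `shape` and mean `1 / lamS`. -/
def typicalCellAreaLaw (lamS : ℝ) : Measure ℝ :=
  (gammaMeasure shape (shape * lamS)).withDensity (fun a => ENNReal.ofReal (lamS * a))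

/-- The load probability mass function `P_x(k)`, `k ≥ 1`, for a ratio `x` of the UE density to
the SBS density. -/
def loadPMF (x : ℝ) (k : ℕ) : ℝ :=
  shape ^ shape / ((k - 1).factorial : ℝ) * (Real.Gamma (k + shape) / Real.Gamma shape) *
    (x ^ (k - 1) / (shape + x) ^ ((k : ℝ) + shape))

/-- SBS densities that avoid overload, for UE density `lamU`, maximum load `K` and tolerance
`rho`: every load beyond `K` has probability at most `rho`, and the probabilities of the loads
beyond `K` do not increase with the load. -/
def overloadFree (lamU : ℝ) (K : ℕ) (rho : ℝ) : Set ℝ :=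
  {lam : ℝ | 0 < lam ∧ (∀ k : ℕ, K < k → loadPMF (lamU / lam) k ≤ rho) ∧
    ∀ k : ℕ, K < k → loadPMF (lamU / lam) (k + 1) ≤ loadPMF (lamU / lam) k}

/-! ### The random network -/

/-- The random network seen from the typical UE, which sits at the origin. -/
structure Network {Ω : Type*} [MeasurableSpace Ω] (μ : Measure Ω) (p : Params) where
  /-- locations of the SBSs -/
  sbs : ℕ → Ω → Plane
  /-- fading power gain of the channel from SBS `i` to the typical UE -/
  fading : ℕ → Ω → ℝ
  /-- content requested at SBS `i` -/
  request : ℕ → Ω → Fin p.J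
  /-- contents cached at SBS `i` -/
  cache : ℕ → Ω → (Fin p.J → Bool)
  /-- number of UEs in the cell of the typical UE, which is included -/
  load : Ω → ℕ
  sbs_hppp : IsHPPP μ sbs p.lamS
  measurable_fading : ∀ i, Measurable (fading i)
  measurable_request : ∀ i, Measurable (request i)
  measurable_cache : ∀ i, Measurable (cache i)
  measurable_load : Measurable load
  /-- Rayleigh fading -/
  fading_law : ∀ i, HasLaw (fading i) (expMeasure 1) μ
  request_law : ∀ i j, μ {ω | request i ω = j} = ENNReal.ofReal (p.zipf j)
  cache_law : ∀ i j, μ {ω | cache i ω j = true} = ENNReal.ofReal (p.cacheProb j)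
  /-- fading, request and cache of one SBS are independent -/
  indep_fading : ∀ i, IndepFun (fading i) (fun ω => (request i ω, cache i ω)) μ
  indep_request : ∀ i, IndepFun (request i) (cache i) μ
  /-- the SBSs are marked independently of each other -/
  indep_marks : iIndepFun (fun i ω => (fading i ω, request i ω, cache i ω)) μ
  /-- the marks are independent of the locations -/
  indep_sbs : IndepFun (fun ω i => sbs i ω)
    (fun ω i => (fading i ω, request i ω, cache i ω)) μ
  /-- given the area `a` of its cell, the number of the UEs other than the typical one is
  Poisson distributed with mean `lamU * a` -/
  load_law : ∀ n : ℕ, μ {ω | load ω = n + 1} =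
    ∫⁻ a, ENNReal.ofReal (Real.exp (-(p.lamU * a)) * (p.lamU * a) ^ n / (n.factorial : ℝ))
      ∂(typicalCellAreaLaw p.lamS)
  indep_load : IndepFun load
    (fun ω => ((fun i => sbs i ω), fun i => (fading i ω, request i ω, cache i ω))) μ

namespace Network

variable {Ω : Type*} [MeasurableSpace Ω] {μ : Measure Ω} {p : Params} (net : Network μ p)

/-- Average power that the typical UE receives from SBS `i`. -/
def meanPower (i : ℕ) (ω : Ω) : ℝ := p.Pa * (p.beta * ‖net.sbs i ω‖ ^ (-p.alphaA))

/-- The typical SBS: the one with the largest average received power. -/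
def serving (ω : Ω) : ℕ := sInf {i : ℕ | ∀ j, net.meanPower j ω ≤ net.meanPower i ω}

/-- SBS `i` has not cached the content that is requested from it (so it uses the backhaul). -/
def Miss (i : ℕ) (ω : Ω) : Prop := net.cache i ω (net.request i ω) = false

/-- The event that the typical SBS has not cached the requested content. -/
def missEvent : Set Ω := {ω | net.Miss (net.serving ω) ω}

open Classical in
/-- Interference from the other backhauled SBSs, summand of SBS `i`. -/
def interferenceTerm (i : ℕ) (ω : Ω) : ℝ :=
  if i ≠ net.serving ω ∧ net.Miss i ω then net.fading i ω * net.meanPower i ω else 0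

/-- Interference from the other backhauled SBSs. -/
def interference (ω : Ω) : ℝ := ∑' i, net.interferenceTerm i ω

/-- Rate of the typical access link when the content comes via the backhaul, for noise power
`noise` at the typical UE. -/
def accessRate (noise : ℝ) (ω : Ω) : ℝ :=
  (1 - p.eta) * p.W / net.load ω *
    Real.logb 2 (1 + net.fading (net.serving ω) ω * net.meanPower (net.serving ω) ω
      / (net.interference ω + noise))

/-- Conditional probability, given that the typical SBS has not cached the content and that the
load is `k`, that the access rate is large enough for a total delivery time below the threshold.
The network is interference-limited: the noise at the typical UE is neglected. -/
def condSCD (k : ℕ) : ℝ :=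
  (μ[|net.missEvent ∩ {ω | net.load ω = k}]).real
    {ω | p.Q / (p.Tth - p.T1) < net.accessRate 0 ω}

/-- The loads at which content delivery is successful. -/
def admissibleLoads : Set ℕ := {k : ℕ | 1 ≤ k ∧ p.eps ≤ net.condSCD k}

/-- Maximum number of UEs that the typical small cell can serve (`0` if there is none). -/
def maxLoad : ℕ := sSup net.admissibleLoads

/-- Successful content delivery (SCD) probability, given that the typical SBS has not cached the
requested content: SCD occurs when, at the actual load, the conditional probability of a large
enough access rate reaches the threshold. -/
def scdProb : ℝ := (μ[|net.missEvent]).real {ω | p.eps ≤ net.condSCD (net.load ω)}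

end Network

end

end SelfBackhaul

open SelfBackhaul

namespace SelfBackhaul

/-! ### The load of a small cell -/

/-! The map `x ↦ λ_S π ‖x‖²` (`discMean`) turns the stations into a Poisson process of rate one on
the half line. The serving station becomes its first point `T_o`, and mean powers become multiples
of `T_i ^ (-α/2)`, so the density drops out. Fix the locations. Since the gain of `o` is
exponential, it exceeds `θ` times the relative interference with probability `E exp (-θ ·
interference)`, and independence of the marks turns this into the product over `i ≠ o` of `1 - p w_i
/ (1 + w_i)`, where `p = 1 - q_hit` and `w_i = θ (T_o / T_i) ^ (α/2)`. A further factor `p` is the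
miss at `o`.

It remains to average a product of functions of `T_o / T_i`. Heuristically, `T_o` has density
`e^{-t}` and the points beyond `t` are again Poisson, which by scaling gives `∫ e^{-t} e^{-p C(θ) t}
dt = 1 / (1 + p C(θ))` with `C(θ) = ∫_1^∞ θ s^{-α/2} / (1 + θ s^{-α/2}) ds` (`laplaceExponent`).
`lintegral_expNeg_first` derives this from the Laplace functional (`IsHPPP.laplace`), without
conditioning on the first point. An infinite loss at the points before `w` encodes the event that
there are none, and the difference between `w = t` and `w = t + d` selects the `t` in a window of
length `d` that ends at `T_o`; then one divides by `d`, integrates over `t` and lets `d → 0`.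

The load is independent of everything else, and load `k` means `θ = 2^{kc} - 1` with `c = Q / ((1 -
η) W (T_th - T₁))`, so `Λ_k = 1 / (1 + p C(2^{kc} - 1))` (`condSCD_eq`). The substitution `t =
s^{-α/2}` makes `C` an Euler integral. `C` is continuous and strictly increasing from `C(0) = 0`, is
at least `(2/α) log (1 + θ)`, and is nonpositive on `(-1, 0]`; hence the load equation has one
solution (`exists_unique_load`).

The law of the load is a gamma mixture of Poisson laws. Its consecutive probabilities have ratio `(k
+ γ) x / (k (γ + x))`, which is at most one iff `x ≤ k`. So overload-freeness reduces to `x ≤ K + 1`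
and `P_x(K + 1) ≤ ρ` (`mem_overloadFree_iff`). For `K ≥ 1`, `P_x(K + 1)` increases in `x` up to `K γ
/ (γ + 1) < K + 1` and decreases afterwards. The minimum density corresponds to the largest
admissible `x`. -/

theorem shape_pos : 0 < shape := by norm_num [shape]

theorem loadPMF_pos {x : ℝ} (hx : 0 < x) (k : ℕ) : 0 < loadPMF x k := by
  have := shape_pos
  unfold loadPMF
  have h1 : 0 < Real.Gamma (k + shape) := Real.Gamma_pos_of_pos (by positivity)
  have h2 : 0 < Real.Gamma shape := Real.Gamma_pos_of_pos this
  positivity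

theorem loadPMF_succ {x : ℝ} (hx : 0 < x) {k : ℕ} (hk : 1 ≤ k) :
    loadPMF x (k + 1) = loadPMF x k * ((k + shape) * x / (k * (shape + x))) := by
  have hs := shape_pos
  obtain ⟨n, rfl⟩ : ∃ n, k = n + 1 := ⟨k - 1, by omega⟩
  have h2 : Real.Gamma shape ≠ 0 := (Real.Gamma_pos_of_pos hs).ne'
  have h3 : Real.Gamma (((n + 1 + 1 : ℕ) : ℝ) + shape) =
      (((n + 1 : ℕ) : ℝ) + shape) * Real.Gamma (((n + 1 : ℕ) : ℝ) + shape) := by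
    rw [← Real.Gamma_add_one (by positivity)]
    push_cast
    ring_nf
  have h4 : (shape + x) ^ (((n + 1 + 1 : ℕ) : ℝ) + shape) =
      (shape + x) ^ (((n + 1 : ℕ) : ℝ) + shape) * (shape + x) := by
    rw [← Real.rpow_add_one (by positivity)]
    push_cast
    ring_nf
  have h5 : 0 < (shape + x) ^ (((n + 1 : ℕ) : ℝ) + shape) := by positivity
  unfold loadPMF
  rw [h3, h4, Nat.add_sub_cancel, Nat.add_sub_cancel, Nat.factorial_succ]
  generalize (shape + x) ^ (((n + 1 : ℕ) : ℝ) + shape) = A at *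
  generalize Real.Gamma (((n + 1 : ℕ) : ℝ) + shape) = G at *
  generalize shape ^ shape = S at *
  push_cast
  field_simp
  ring

theorem loadPMF_succ_le_iff {x : ℝ} (hx : 0 < x) {k : ℕ} (hk : 1 ≤ k) :
    loadPMF x (k + 1) ≤ loadPMF x k ↔ x ≤ k := by
  have hs := shape_pos
  have hk' : (0 : ℝ) < k := by exact_mod_cast hk
  rw [loadPMF_succ hx hk, mul_le_iff_le_one_right (loadPMF_pos hx k), div_le_one (by positivity)]
  constructor <;> intro h <;> nlinarith

theorem loadPMF_le_of_le {x : ℝ} (hx : 0 < x) {K : ℕ} (hxK : x ≤ (K : ℝ) + 1) {k : ℕ}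
    (hk : K < k) : loadPMF x k ≤ loadPMF x (K + 1) := by
  induction k, hk using Nat.le_induction with
  | base => exact le_rfl
  | succ k hk ih =>
    refine le_trans ((loadPMF_succ_le_iff hx (by omega)).2 (hxK.trans ?_)) ih
    exact_mod_cast hk

/-- Overload-freeness only concerns the ratio of the densities and the first load in excess. -/
theorem mem_overloadFree_iff {lamU lam rho : ℝ} (hU : 0 < lamU) (hl : 0 < lam) {K : ℕ} :
    lam ∈ overloadFree lamU K rho ↔
      lamU / lam ≤ (K : ℝ) + 1 ∧ loadPMF (lamU / lam) (K + 1) ≤ rho := by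
  have hx : 0 < lamU / lam := div_pos hU hl
  constructor
  · rintro ⟨-, h1, h2⟩
    refine ⟨?_, h1 _ (Nat.lt_succ_self K)⟩
    have := (loadPMF_succ_le_iff hx (by omega)).1 (h2 _ (Nat.lt_succ_self K))
    exact_mod_cast this
  · rintro ⟨h1, h2⟩
    refine ⟨hl, fun k hk => (loadPMF_le_of_le hx h1 hk).trans h2, fun k hk =>
      (loadPMF_succ_le_iff hx (by omega)).2 (h1.trans ?_)⟩
    exact_mod_cast hk

/-- The dependence on `x` is isolated in one exponent, so that monotonicity in `x` is a matter of
the sign of a derivative. -/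
theorem loadPMF_eq_exp {x : ℝ} (hx : 0 < x) (K : ℕ) :
    loadPMF x (K + 1) = shape ^ shape / (K.factorial : ℝ) *
      (Real.Gamma ((K + 1 : ℕ) + shape) / Real.Gamma shape) *
      Real.exp (K * Real.log x - ((K + 1 : ℕ) + shape) * Real.log (shape + x)) := by
  have hs := shape_pos
  rw [loadPMF, Real.exp_sub, Real.rpow_def_of_pos (by positivity : 0 < shape + x),
    ← Real.log_pow, Real.exp_log (by positivity), Nat.add_sub_cancel]
  rw [mul_comm (Real.log (shape + x))]

theorem loadPMF_const_pos (K : ℕ) : 0 < shape ^ shape / (K.factorial : ℝ) *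
    (Real.Gamma ((K + 1 : ℕ) + shape) / Real.Gamma shape) := by
  have hs := shape_pos
  have h1 : 0 < Real.Gamma ((K + 1 : ℕ) + shape) := Real.Gamma_pos_of_pos (by positivity)
  have h2 : 0 < Real.Gamma shape := Real.Gamma_pos_of_pos hs
  positivity

theorem hasDerivAt_logLoad {x : ℝ} (hx : 0 < x) (K : ℕ) :
    HasDerivAt (fun x => K * Real.log x - ((K + 1 : ℕ) + shape) * Real.log (shape + x))
      ((K * shape - (shape + 1) * x) / (x * (shape + x))) x := by
  have hs := shape_pos
  have h1 : shape + x ≠ 0 := by positivity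
  have h := ((Real.hasDerivAt_log hx.ne').const_mul (K : ℝ)).sub
    ((((hasDerivAt_id' x).const_add shape).log h1).const_mul (((K + 1 : ℕ) : ℝ) + shape))
  refine h.congr_deriv ?_
  push_cast
  field_simp
  ring

/-- The logarithmic derivative has the sign of `K γ - (γ + 1) x`, which places the mode at the right
end of the interval. For `K = 0` the interval is empty. -/
theorem loadPMF_strictMonoOn (K : ℕ) :
    StrictMonoOn (fun x => loadPMF x (K + 1)) (Ioc 0 (K * shape / (shape + 1))) := by
  have hs := shape_pos
  have h : StrictMonoOn (fun x => K * Real.log x - ((K + 1 : ℕ) + shape) * Real.log (shape + x))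
      (Ioc 0 (K * shape / (shape + 1))) := by
    refine strictMonoOn_of_deriv_pos (convex_Ioc _ _) (fun x hx =>
      (hasDerivAt_logLoad hx.1 K).continuousAt.continuousWithinAt) fun x hx => ?_
    rw [interior_Ioc] at hx
    rw [(hasDerivAt_logLoad hx.1 K).deriv]
    have := hx.1
    have h2 := (lt_div_iff₀ (by positivity)).1 hx.2
    exact div_pos (by nlinarith) (by positivity)
  intro x hx y hy hxy
  simp only [loadPMF_eq_exp hx.1, loadPMF_eq_exp hy.1]
  exact mul_lt_mul_of_pos_left (Real.exp_lt_exp.2 (h hx hy hxy)) (loadPMF_const_pos K)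

theorem loadPMF_antitoneOn {K : ℕ} (hK : 1 ≤ K) :
    AntitoneOn (fun x => loadPMF x (K + 1)) (Ici (K * shape / (shape + 1))) := by
  have hs := shape_pos
  have hK' : (0 : ℝ) < K := by exact_mod_cast hK
  have hm : 0 < K * shape / (shape + 1) := by positivity
  have h : AntitoneOn (fun x => K * Real.log x - ((K + 1 : ℕ) + shape) * Real.log (shape + x))
      (Ici (K * shape / (shape + 1))) := by
    refine antitoneOn_of_deriv_nonpos (convex_Ici _) (fun x hx =>
      (hasDerivAt_logLoad (hm.trans_le hx) K).continuousAt.continuousWithinAt) (fun x hx => ?_)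
      fun x hx => ?_
    all_goals
      rw [interior_Ici] at hx
      have hx0 := hm.trans hx
    · exact (hasDerivAt_logLoad hx0 K).differentiableAt.differentiableWithinAt
    · rw [(hasDerivAt_logLoad hx0 K).deriv]
      have h2 := (div_lt_iff₀ (by positivity : 0 < shape + 1)).1 hx
      exact div_nonpos_of_nonpos_of_nonneg (by nlinarith) (by positivity)
  intro x hx y hy hxy
  simp only [loadPMF_eq_exp (hm.trans_le hx), loadPMF_eq_exp (hm.trans_le hy)]
  exact mul_le_mul_of_nonneg_left (Real.exp_le_exp.2 (h hx hy hxy)) (loadPMF_const_pos K).le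

theorem isLeast_overloadFree_of_le {lamU rho : ℝ} (hU : 0 < lamU) {K : ℕ}
    (h : loadPMF ((K : ℝ) + 1) (K + 1) ≤ rho) :
    IsLeast (overloadFree lamU K rho) (lamU / ((K : ℝ) + 1)) := by
  have hK : (0 : ℝ) < K + 1 := by positivity
  refine ⟨(mem_overloadFree_iff hU (div_pos hU hK)).2 ?_, fun lam hlam => ?_⟩
  · rw [div_div_cancel₀ hU.ne']
    exact ⟨le_rfl, h⟩
  · have h1 := ((mem_overloadFree_iff hU hlam.1).1 hlam).1
    rw [div_le_iff₀ hlam.1] at h1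
    rw [div_le_iff₀ hK]
    linarith

theorem exists_isLeast_overloadFree {lamU rho : ℝ} (hU : 0 < lamU) (hrho : 0 < rho) {K : ℕ}
    (hK : 1 ≤ K) (h : rho < loadPMF ((K : ℝ) + 1) (K + 1)) :
    ∃ m ∈ Set.Ioc 0 ((K : ℝ) * shape / (shape + 1)),
      loadPMF m (K + 1) = rho ∧
      (∀ m' ∈ Set.Ioc 0 ((K : ℝ) * shape / (shape + 1)), loadPMF m' (K + 1) = rho → m' = m) ∧
      IsLeast (overloadFree lamU K rho) (lamU / m) := by
  have hs := shape_pos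
  have hK' : (0 : ℝ) < K := by exact_mod_cast hK
  set M := (K : ℝ) * shape / (shape + 1) with hM
  have hM0 : 0 < M := by positivity
  have hMK : M ≤ K + 1 := by
    rw [hM, div_le_iff₀ (by positivity)]
    nlinarith
  -- Past the mode the probability is at least its value at `K + 1`, which exceeds `rho`; no
  -- admissible ratio lies in `[M, K + 1]`.
  have hMr : ∀ x, M ≤ x → x ≤ K + 1 → rho < loadPMF x (K + 1) := fun x h1 h2 =>
    h.trans_le (loadPMF_antitoneOn hK h1 hMK h2)
  have hcont : ContinuousOn (fun x => loadPMF x (K + 1)) (Icc 0 M) := by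
    unfold loadPMF
    refine continuousOn_const.mul (ContinuousOn.div (by fun_prop)
      (ContinuousOn.rpow_const (by fun_prop) fun x hx => Or.inl ?_) fun x hx => ?_)
    all_goals have : 0 < shape + x := by linarith [hx.1]
    · exact this.ne'
    · positivity
  -- `K ≥ 1` is essential: for `K = 0` the factor `0 ^ 0 = 1` would leave a positive value.
  have h0 : loadPMF 0 (K + 1) = 0 := by
    simp [loadPMF, show K ≠ 0 by omega]
  obtain ⟨m, hm, hmr⟩ := intermediate_value_Icc hM0.le hcont
    (show rho ∈ Icc (loadPMF 0 (K + 1)) (loadPMF M (K + 1)) from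
      ⟨h0.le.trans hrho.le, (hMr M le_rfl hMK).le⟩)
  have hm0 : 0 < m := by
    refine lt_of_le_of_ne hm.1 fun h' => ?_
    subst h'
    exact hrho.ne (h0.symm.trans hmr)
  have hmono := loadPMF_strictMonoOn K
  refine ⟨m, ⟨hm0, hm.2⟩, hmr, fun m' hm' h' => hmono.injOn hm' ⟨hm0, hm.2⟩ (h'.trans hmr.symm),
    (mem_overloadFree_iff hU (div_pos hU hm0)).2 ?_, fun lam hlam => ?_⟩
  · rw [div_div_cancel₀ hU.ne']
    exact ⟨hm.2.trans hMK, hmr.le⟩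
  · obtain ⟨h1, h2⟩ := (mem_overloadFree_iff hU hlam.1).1 hlam
    have hx : 0 < lamU / lam := div_pos hU hlam.1
    have h3 : lamU / lam ≤ M := by
      by_contra! hc
      exact absurd h2 (not_le.2 (hMr _ hc.le h1))
    have h4 : lamU / lam ≤ m := by
      by_contra! hc
      have := hmono ⟨hm0, hm.2⟩ ⟨hx, h3⟩ hc
      simp only [hmr] at this
      linarith
    rw [div_le_iff₀ hlam.1] at h4
    rw [div_le_iff₀ hm0]
    linarith

/-- The gamma density, the area weight and the Poisson weight multiply to `a ^ (n + γ)` times an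
exponential of rate `λ_U + γ λ_S`, up to a constant: a Gamma integral of argument `n + 1 + γ`. -/
theorem lintegral_poisson_typicalCellAreaLaw {lamU lamS : ℝ} (hU : 0 < lamU) (hS : 0 < lamS)
    (n : ℕ) :
    ∫⁻ a, ENNReal.ofReal (Real.exp (-(lamU * a)) * (lamU * a) ^ n / (n.factorial : ℝ))
      ∂(typicalCellAreaLaw lamS) = ENNReal.ofReal (loadPMF (lamU / lamS) (n + 1)) := by
  have hs := shape_pos
  have hG : 0 < Real.Gamma shape := Real.Gamma_pos_of_pos hs
  have hg : Measurable (gammaPDF shape (shape * lamS)) := (measurable_gammaPDFReal _ _).ennreal_ofReal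
  have hint := Real.integral_rpow_mul_exp_neg_mul_Ioi (a := ((n + 1 : ℕ) : ℝ) + shape)
    (r := lamU + shape * lamS) (by positivity) (by positivity)
  have hG' : 0 < Real.Gamma (((n + 1 : ℕ) : ℝ) + shape) := Real.Gamma_pos_of_pos (by positivity)
  have hI : IntegrableOn (fun t => t ^ (((n + 1 : ℕ) : ℝ) + shape - 1) *
      Real.exp (-((lamU + shape * lamS) * t))) (Ioi 0) := by
    -- A non-integrable function has integral zero by convention, whereas this integral is positive.
    refine not_imp_comm.1 integral_undef ?_
    rw [hint]
    positivity
  set C : ℝ := lamU ^ n / n.factorial * lamS * ((shape * lamS) ^ shape / Real.Gamma shape) with hC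
  have hC0 : 0 ≤ C := by positivity
  rw [typicalCellAreaLaw, lintegral_withDensity_eq_lintegral_mul _ (by fun_prop) (by fun_prop),
    gammaMeasure, lintegral_withDensity_eq_lintegral_mul _ hg (by fun_prop),
    ← lintegral_add_compl _ measurableSet_Iic (A := Iic (0 : ℝ)), compl_Iic]
  have hz : ∫⁻ x in Iic (0 : ℝ), (gammaPDF shape (shape * lamS) *
      ((fun a => ENNReal.ofReal (lamS * a)) * fun a =>
        ENNReal.ofReal (Real.exp (-(lamU * a)) * (lamU * a) ^ n / (n.factorial : ℝ)))) x = 0 := by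
    rw [setLIntegral_congr_fun (g := fun _ => 0) measurableSet_Iic fun x hx => ?_]
    · simp
    · simp only [Pi.mul_apply]
      rw [ENNReal.ofReal_of_nonpos (mul_nonpos_of_nonneg_of_nonpos hS.le hx)]
      simp
  rw [hz, zero_add]
  have hp : ∀ x ∈ Ioi (0 : ℝ), (gammaPDF shape (shape * lamS) *
      ((fun a => ENNReal.ofReal (lamS * a)) * fun a =>
        ENNReal.ofReal (Real.exp (-(lamU * a)) * (lamU * a) ^ n / (n.factorial : ℝ)))) x =
      ENNReal.ofReal (C * (x ^ (((n + 1 : ℕ) : ℝ) + shape - 1) *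
      Real.exp (-((lamU + shape * lamS) * x)))) := by
    intro x hx
    have hx : 0 < x := hx
    simp only [Pi.mul_apply]
    rw [gammaPDF_of_nonneg hx.le, ← ENNReal.ofReal_mul (by positivity),
      ← ENNReal.ofReal_mul (by positivity)]
    congr 1
    have e1 : x ^ (((n + 1 : ℕ) : ℝ) + shape - 1) = x ^ (shape - 1) * x * x ^ n := by
      rw [← Real.rpow_add_one hx.ne', ← Real.rpow_add_natCast hx.ne']
      congr 1
      push_cast
      ring
    have e2 : Real.exp (-((lamU + shape * lamS) * x)) =
        Real.exp (-(shape * lamS * x)) * Real.exp (-(lamU * x)) := by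
      rw [← Real.exp_add]
      congr 1
      ring
    rw [e1, e2, hC, mul_pow]
    ring
  rw [setLIntegral_congr_fun measurableSet_Ioi hp, ← ofReal_integral_eq_lintegral_ofReal
    (hI.const_mul C) ?_, integral_const_mul, hint]
  · congr 1
    have e3 : (1 / (lamU + shape * lamS)) ^ (((n + 1 : ℕ) : ℝ) + shape) =
        1 / (lamS * lamS ^ n * lamS ^ shape *
          (shape + lamU / lamS) ^ (((n + 1 : ℕ) : ℝ) + shape)) := by
      rw [Real.div_rpow zero_le_one (by positivity), Real.one_rpow]
      have : lamS * lamS ^ n * lamS ^ shape = lamS ^ (((n + 1 : ℕ) : ℝ) + shape) := by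
        rw [Real.rpow_add hS, Real.rpow_natCast]
        ring
      rw [this, ← Real.mul_rpow hS.le (by positivity)]
      congr 2
      field_simp
      ring
    rw [e3, hC, loadPMF, Real.mul_rpow hs.le hS.le, Nat.add_sub_cancel, div_pow]
    have h1 : (shape + lamU / lamS) ^ (((n + 1 : ℕ) : ℝ) + shape) ≠ 0 := by positivity
    have h2 : lamS ^ shape ≠ 0 := by positivity
    generalize (shape + lamU / lamS) ^ (((n + 1 : ℕ) : ℝ) + shape) = A at *
    generalize lamS ^ shape = B at *
    generalize shape ^ shape = D at *
    field_simp
  · refine (ae_restrict_iff' measurableSet_Ioi).2 (Filter.Eventually.of_forall fun x hx => ?_)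
    have hx : 0 < x := hx
    show 0 ≤ _
    positivity

/-! ### The equation for the maximum load -/

/-- The Laplace exponent `2 ∫_1^∞ u / (1 + u ^ al / th) du` of the interference, normalized by the
distance to the serving station, in the variable `u ^ (-al)`. -/
noncomputable def laplaceExponent (al th : ℝ) : ℝ :=
  2 / al * ∫ t in (0 : ℝ)..1, t ^ (-(2 / al)) * (th * (1 + th * t)⁻¹)

/-- Here `c = b + 1`, so the factor `(1 - t) ^ (c - b - 1)` is one and the Gamma quotient reduces to
`b = (al - 2) / al`. With `th = 2 ^ x - 1` the prefactor is `2 th / (al - 2)` and `1 - z t = 1 + th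
t`. -/
theorem laplaceExponent_eq_gauss2F1 {al : ℝ} (hal : 2 < al) (x : ℝ) :
    (2 ^ (x + 1) - 2) / (al - 2) *
      gauss2F1 1 ((al - 2) / al) ((2 * al - 2) / al) (1 - 2 ^ x) =
    laplaceExponent al (2 ^ x - 1) := by
  have h0 : al ≠ 0 := by linarith
  have h2 : al - 2 ≠ 0 := by linarith
  have hb : 0 < (al - 2) / al := div_pos (by linarith) (by linarith)
  have hc : (2 * al - 2) / al = (al - 2) / al + 1 := by field_simp; ring
  have hb1 : (al - 2) / al - 1 = -(2 / al) := by field_simp; ring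
  have hG : Real.Gamma ((al - 2) / al) ≠ 0 := (Real.Gamma_pos_of_pos hb).ne'
  have e : ∀ t : ℝ, 1 - (1 - 2 ^ x) * t = 1 + (2 ^ x - 1) * t := fun t => by ring
  rw [gauss2F1, hc, Real.Gamma_add_one hb.ne', hb1, add_sub_cancel_left, Real.Gamma_one,
    laplaceExponent]
  simp only [sub_self, Real.rpow_zero, mul_one, Real.rpow_neg_one, e]
  have e2 : ∀ t : ℝ, t ^ (-(2 / al)) * ((2 ^ x - 1) * (1 + (2 ^ x - 1) * t)⁻¹) =
      (2 ^ x - 1) * (t ^ (-(2 / al)) * (1 + (2 ^ x - 1) * t)⁻¹) := fun t => by ring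
  simp only [e2]
  rw [intervalIntegral.integral_const_mul, mul_div_cancel_right₀ _ hG,
    Real.rpow_add_one (by norm_num)]
  field_simp

theorem intervalIntegrable_laplaceExponent {al th : ℝ} (hal : 2 < al) (hth : 0 ≤ th) :
    IntervalIntegrable (fun t : ℝ => t ^ (-(2 / al)) * (th * (1 + th * t)⁻¹)) volume 0 1 := by
  have h1 : 2 / al < 1 := (div_lt_one (by linarith)).2 hal
  refine (intervalIntegral.intervalIntegrable_rpow' (by linarith)).mul_continuousOn ?_
  refine ContinuousOn.mul continuousOn_const (ContinuousOn.inv₀ (by fun_prop) fun t ht => ?_)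
  rw [uIcc_of_le zero_le_one] at ht
  have := mul_nonneg hth ht.1
  linarith

theorem laplaceExponent_sub {al a b : ℝ} (hal : 2 < al) (ha : 0 ≤ a) (hb : 0 ≤ b) :
    laplaceExponent al b - laplaceExponent al a = 2 / al * ∫ t in (0 : ℝ)..1,
      t ^ (-(2 / al)) * ((b - a) * ((1 + a * t)⁻¹ * (1 + b * t)⁻¹)) := by
  rw [laplaceExponent, laplaceExponent, ← mul_sub, ← intervalIntegral.integral_sub
    (intervalIntegrable_laplaceExponent hal hb) (intervalIntegrable_laplaceExponent hal ha)]
  congr 1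
  refine intervalIntegral.integral_congr fun t ht => ?_
  rw [uIcc_of_le zero_le_one] at ht
  have h1 : 1 + a * t ≠ 0 := by have := mul_nonneg ha ht.1; linarith
  have h2 : 1 + b * t ≠ 0 := by have := mul_nonneg hb ht.1; linarith
  linear_combination t ^ (-(2 / al)) * (-b * (1 + b * t)⁻¹ * mul_inv_cancel₀ h1 +
    a * (1 + a * t)⁻¹ * mul_inv_cancel₀ h2)

theorem intervalIntegrable_laplaceExponent_sub {al a b : ℝ} (hal : 2 < al) (ha : 0 ≤ a)
    (hb : 0 ≤ b) : IntervalIntegrable (fun t : ℝ =>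
      t ^ (-(2 / al)) * ((b - a) * ((1 + a * t)⁻¹ * (1 + b * t)⁻¹))) volume 0 1 := by
  refine ((intervalIntegrable_laplaceExponent hal hb).sub
    (intervalIntegrable_laplaceExponent hal ha)).congr fun t ht => ?_
  rw [uIoc_of_le zero_le_one] at ht
  have h1 : 1 + a * t ≠ 0 := by have := mul_nonneg ha ht.1.le; linarith
  have h2 : 1 + b * t ≠ 0 := by have := mul_nonneg hb ht.1.le; linarith
  linear_combination t ^ (-(2 / al)) * (-b * (1 + b * t)⁻¹ * mul_inv_cancel₀ h1 +
    a * (1 + a * t)⁻¹ * mul_inv_cancel₀ h2)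

/-- On `(0, 1)` the weight `t ^ (-(2 / al))` is at least one and the denominators are at most their
values at `t = 1`. The bound is explicit and positive for `a < b`, which gives strict monotonicity.
-/
theorem laplaceExponent_sub_ge {al a b : ℝ} (hal : 2 < al) (ha : 0 ≤ a) (hab : a ≤ b) :
    2 / al * ((b - a) * ((1 + a)⁻¹ * (1 + b)⁻¹)) ≤
      laplaceExponent al b - laplaceExponent al a := by
  have hb := ha.trans hab
  rw [laplaceExponent_sub hal ha hb]
  refine mul_le_mul_of_nonneg_left ?_ (by have : 0 < al := by linarith
                                          positivity)
  have : (b - a) * ((1 + a)⁻¹ * (1 + b)⁻¹) =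
      ∫ t in (0 : ℝ)..1, (b - a) * ((1 + a)⁻¹ * (1 + b)⁻¹) := by simp
  rw [this]
  refine intervalIntegral.integral_mono_on_of_le_Ioo zero_le_one (by simp)
    (intervalIntegrable_laplaceExponent_sub hal ha hb) fun t ht => ?_
  have h1 : 1 ≤ t ^ (-(2 / al)) :=
    Real.one_le_rpow_of_pos_of_le_one_of_nonpos ht.1 ht.2.le
      (by have : 0 < al := by linarith
          have : 0 < 2 / al := by positivity
          linarith)
  have hab' : 0 ≤ b - a := by linarith
  have hat := mul_nonneg ha ht.1.le
  have hbt := mul_nonneg hb ht.1.le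
  have hat' : a * t ≤ a := mul_le_of_le_one_right ha ht.2.le
  have hbt' : b * t ≤ b := mul_le_of_le_one_right hb ht.2.le
  calc (b - a) * ((1 + a)⁻¹ * (1 + b)⁻¹)
      ≤ (b - a) * ((1 + a * t)⁻¹ * (1 + b * t)⁻¹) := by gcongr
    _ ≤ t ^ (-(2 / al)) * ((b - a) * ((1 + a * t)⁻¹ * (1 + b * t)⁻¹)) :=
        le_mul_of_one_le_left (by positivity) h1

theorem laplaceExponent_strictMonoOn {al : ℝ} (hal : 2 < al) :
    StrictMonoOn (laplaceExponent al) (Ici 0) := by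
  intro a ha b hb hab
  have ha : 0 ≤ a := ha
  have hb : 0 ≤ b := hb
  have h := laplaceExponent_sub_ge hal ha hab.le
  have : 0 < 2 / al * ((b - a) * ((1 + a)⁻¹ * (1 + b)⁻¹)) := by
    have : 0 < al := by linarith
    have : 0 < b - a := by linarith
    positivity
  linarith

/-- Dominated convergence: for `0 ≤ b < a + 1` the integrand is at most `(a + 1) t ^ (-(2 / al))`,
integrable because `al > 2`. -/
theorem laplaceExponent_continuousOn {al : ℝ} (hal : 2 < al) :
    ContinuousOn (laplaceExponent al) (Ici 0) := by
  have hal1 : 2 / al < 1 := (div_lt_one (by linarith)).2 hal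
  refine ContinuousOn.mul continuousOn_const fun a ha => ?_
  have ha : 0 ≤ a := ha
  refine intervalIntegral.continuousWithinAt_of_dominated_interval
    (bound := fun t => t ^ (-(2 / al)) * (a + 1)) ?_ ?_ ?_ ?_
  · exact Filter.Eventually.of_forall fun b => Measurable.aestronglyMeasurable (by fun_prop)
  · filter_upwards [self_mem_nhdsWithin,
      mem_nhdsWithin_of_mem_nhds (Iio_mem_nhds (lt_add_one a))] with b hb hb'
    have hb : 0 ≤ b := hb
    refine Filter.Eventually.of_forall fun t ht => ?_
    rw [uIoc_of_le zero_le_one] at ht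
    have ht0 := ht.1
    rw [Real.norm_of_nonneg (by positivity)]
    refine mul_le_mul_of_nonneg_left ?_ (by positivity)
    have h1 : (1 + b * t)⁻¹ ≤ 1 := inv_le_one_of_one_le₀ (by nlinarith [mul_nonneg hb ht0.le])
    have hb' : b < a + 1 := hb'
    nlinarith
  · exact (intervalIntegral.intervalIntegrable_rpow' (by linarith)).mul_const _
  · refine Filter.Eventually.of_forall fun t ht => ?_
    rw [uIoc_of_le zero_le_one] at ht
    refine ContinuousAt.continuousWithinAt ?_
    have : 1 + a * t ≠ 0 := by have := mul_nonneg ha ht.1.le; linarith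
    fun_prop (disch := assumption)

theorem laplaceExponent_zero (al : ℝ) : laplaceExponent al 0 = 0 := by simp [laplaceExponent]

/-- Dropping the weight, which is at least one, leaves the derivative of `log (1 + th t)`. The bound
shows that the Laplace exponent is unbounded. -/
theorem laplaceExponent_ge_log {al th : ℝ} (hal : 2 < al) (hth : 0 < th) :
    2 / al * Real.log (1 + th) ≤ laplaceExponent al th := by
  rw [laplaceExponent]
  refine mul_le_mul_of_nonneg_left ?_ (by have : 0 < al := by linarith
                                          positivity)
  have hder : ∀ t ∈ uIcc (0 : ℝ) 1, HasDerivAt (fun t => Real.log (1 + th * t))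
      (th * (1 + th * t)⁻¹) t := fun t ht => by
    rw [uIcc_of_le zero_le_one] at ht
    have h : 1 + th * t ≠ 0 := by have := mul_nonneg hth.le ht.1; linarith
    refine ((((hasDerivAt_id' t).const_mul th).const_add 1).log h).congr_deriv ?_
    rw [mul_one, div_eq_mul_inv]
  have hint : IntervalIntegrable (fun t : ℝ => th * (1 + th * t)⁻¹) volume 0 1 := by
    refine ContinuousOn.intervalIntegrable ?_
    refine continuousOn_const.mul (ContinuousOn.inv₀ (by fun_prop) fun t ht => ?_)
    rw [uIcc_of_le zero_le_one] at ht
    have := mul_nonneg hth.le ht.1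
    linarith
  have h := intervalIntegral.integral_eq_sub_of_hasDerivAt hder hint
  simp only [mul_one, mul_zero, add_zero, Real.log_one, sub_zero] at h
  rw [← h]
  refine intervalIntegral.integral_mono_on_of_le_Ioo zero_le_one hint
    (intervalIntegrable_laplaceExponent hal hth.le) fun t ht => ?_
  have h1 : 1 ≤ t ^ (-(2 / al)) :=
    Real.one_le_rpow_of_pos_of_le_one_of_nonpos ht.1 ht.2.le
      (by have : 0 < al := by linarith
          have : 0 < 2 / al := by positivity
          linarith)
  have := ht.1
  exact le_mul_of_one_le_left (by positivity) h1

/-- Negative candidates `x` for the load equation give `th = 2 ^ (x c) - 1` in this range, so they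
cannot reach a positive right-hand side. -/
theorem laplaceExponent_nonpos {al th : ℝ} (hal : 2 < al) (hth : th ≤ 0) (hth1 : -1 < th) :
    laplaceExponent al th ≤ 0 := by
  refine mul_nonpos_of_nonneg_of_nonpos (by have : 0 < al := by linarith
                                            positivity) ?_
  rw [← neg_nonneg, ← intervalIntegral.integral_neg]
  refine intervalIntegral.integral_nonneg zero_le_one fun t ht => ?_
  have h1 : 0 < 1 + th * t := by nlinarith [ht.1, ht.2]
  have h2 : 0 ≤ t ^ (-(2 / al)) := Real.rpow_nonneg ht.1 _
  have h3 := mul_nonneg h2 (mul_nonneg (neg_nonneg.2 hth) (inv_nonneg.2 h1.le))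
  linarith

theorem exists_laplaceExponent_eq {al D : ℝ} (hal : 2 < al) (hD : 0 < D) :
    ∃ th : ℝ, 0 < th ∧ laplaceExponent al th = D := by
  have hal0 : 0 < al := by linarith
  -- Chosen so that the logarithmic lower bound at `B` equals `D`.
  set B : ℝ := Real.exp (al / 2 * D) - 1 with hB
  have hB0 : 0 < B := sub_pos.2 (Real.one_lt_exp_iff.2 (by positivity))
  have hDB : D ≤ laplaceExponent al B := by
    refine le_trans (le_of_eq ?_) (laplaceExponent_ge_log hal hB0)
    rw [hB, add_sub_cancel, Real.log_exp]
    field_simp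
  obtain ⟨th, hth, h⟩ := intermediate_value_Icc hB0.le
    ((laplaceExponent_continuousOn hal).mono Icc_subset_Ici_self)
    (show D ∈ Icc (laplaceExponent al 0) (laplaceExponent al B) from
      ⟨(laplaceExponent_zero al).le.trans hD.le, hDB⟩)
  refine ⟨th, lt_of_le_of_ne hth.1 fun h0 => ?_, h⟩
  subst h0
  rw [laplaceExponent_zero] at h
  exact hD.ne h

/-- The equation for the maximum load has exactly one solution, and the Laplace exponent is below
the right-hand side exactly up to this solution. -/
theorem exists_unique_load {al c D : ℝ} (hal : 2 < al) (hc : 0 < c) (hD : 0 < D) :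
    ∃ kappa : ℝ, 0 < kappa ∧
      (∀ x : ℝ, laplaceExponent al (2 ^ (x * c) - 1) = D ↔ x = kappa) ∧
      ∀ x : ℝ, 0 ≤ x → (laplaceExponent al (2 ^ (x * c) - 1) ≤ D ↔ x ≤ kappa) := by
  obtain ⟨th, hth, h⟩ := exists_laplaceExponent_eq hal hD
  have hmem : ∀ x : ℝ, 0 ≤ x → (2 : ℝ) ^ (x * c) - 1 ∈ Ici (0 : ℝ) := fun x hx => by
    have := Real.one_le_rpow one_le_two (mul_nonneg hx hc.le)
    exact sub_nonneg.2 this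
  set kappa : ℝ := Real.logb 2 (1 + th) / c with hk
  have hk0 : 0 < kappa := div_pos (Real.logb_pos one_lt_two (by linarith)) hc
  have hkth : (2 : ℝ) ^ (kappa * c) - 1 = th := by
    rw [hk, div_mul_cancel₀ _ hc.ne', Real.rpow_logb two_pos (by norm_num) (by linarith)]
    ring
  have hle : ∀ x : ℝ, 0 ≤ x → (laplaceExponent al (2 ^ (x * c) - 1) ≤ D ↔ x ≤ kappa) := by
    intro x hx
    rw [← h, ← hkth, (laplaceExponent_strictMonoOn hal).le_iff_le (hmem x hx) (hmem _ hk0.le),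
      sub_le_sub_iff_right, Real.rpow_le_rpow_left_iff one_lt_two, mul_le_mul_iff_left₀ hc]
  refine ⟨kappa, hk0, fun x => ⟨fun hx => ?_, fun hx => by rw [hx, hkth, h]⟩, hle⟩
  have hx0 : 0 ≤ x := by
    by_contra! hneg
    have h1 : (2 : ℝ) ^ (x * c) ≤ 1 :=
      Real.rpow_le_one_of_one_le_of_nonpos one_le_two (mul_nonpos_of_nonpos_of_nonneg hneg.le hc.le)
    have h2 : (0 : ℝ) < 2 ^ (x * c) := by positivity
    have := laplaceExponent_nonpos hal (sub_nonpos.2 h1) (by linarith)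
    linarith
  refine le_antisymm ((hle x hx0).1 hx.le) ?_
  by_contra! hlt
  have h1 := (laplaceExponent_strictMonoOn hal) (hmem x hx0) (hmem _ hk0.le)
    (sub_lt_sub_right ((Real.rpow_lt_rpow_left_iff one_lt_two).2 (mul_lt_mul_of_pos_right hlt hc)) 1)
  rw [hkth, h, hx] at h1
  exact lt_irrefl _ h1

/-! ### The exponential `exp (-x)` on the extended half line -/

/-- `exp (-x)` for `x ∈ [0, ∞]`. -/
noncomputable def expNeg (x : ℝ≥0∞) : ℝ≥0∞ := EReal.exp (-(x : EReal))

@[fun_prop]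
theorem continuous_expNeg : Continuous expNeg :=
  ENNReal.continuous_exp.comp (continuous_neg.comp continuous_coe_ennreal_ereal)

@[fun_prop]
theorem measurable_expNeg : Measurable expNeg := continuous_expNeg.measurable

@[simp]
theorem expNeg_zero : expNeg 0 = 1 := by simp [expNeg]

@[simp]
theorem expNeg_top : expNeg ⊤ = 0 := by simp [expNeg]

theorem expNeg_antitone : Antitone expNeg := fun x y h => by
  refine EReal.exp_monotone ?_
  rw [EReal.neg_le_neg_iff]
  exact_mod_cast h

theorem expNeg_le_one (x : ℝ≥0∞) : expNeg x ≤ 1 := by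
  simpa using expNeg_antitone (bot_le : ⊥ ≤ x)

theorem expNeg_ne_top (x : ℝ≥0∞) : expNeg x ≠ ⊤ := ((expNeg_le_one x).trans_lt ENNReal.one_lt_top).ne

theorem expNeg_add (x y : ℝ≥0∞) : expNeg (x + y) = expNeg x * expNeg y := by
  rw [expNeg, EReal.coe_ennreal_add, EReal.neg_add (Or.inl (EReal.coe_ennreal_ne_bot x))
    (Or.inr (EReal.coe_ennreal_ne_bot y)), sub_eq_add_neg, EReal.exp_add]
  rfl

theorem expNeg_ofReal {x : ℝ} (hx : 0 ≤ x) :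
    expNeg (ENNReal.ofReal x) = ENNReal.ofReal (Real.exp (-x)) := by
  rw [expNeg, EReal.coe_ennreal_ofReal, max_eq_left hx, ← EReal.coe_neg, EReal.exp_coe]

theorem expNeg_ofReal_neg_log {x : ℝ} (hx : 0 < x) (hx1 : x ≤ 1) :
    expNeg (ENNReal.ofReal (-Real.log x)) = ENNReal.ofReal x := by
  rw [expNeg_ofReal (neg_nonneg.2 (Real.log_nonpos hx.le hx1)), neg_neg, Real.exp_log hx]

theorem expNeg_sum {ι : Type*} (s : Finset ι) (f : ι → ℝ≥0∞) :
    expNeg (∑ i ∈ s, f i) = ∏ i ∈ s, expNeg (f i) := by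
  classical
  induction s using Finset.induction_on with
  | empty => simp
  | insert i s hi ih => rw [Finset.sum_insert hi, Finset.prod_insert hi, expNeg_add, ih]

theorem expNeg_nat_mul (n : ℕ) (x : ℝ≥0∞) : expNeg (n * x) = expNeg x ^ n := by
  have := expNeg_sum (Finset.range n) fun _ => x
  simpa using this

theorem tendsto_prod_expNeg (f : ℕ → ℝ≥0∞) :
    Filter.Tendsto (fun n => ∏ i ∈ Finset.range n, expNeg (f i)) Filter.atTop
      (nhds (expNeg (∑' i, f i))) := by
  simp only [← expNeg_sum]
  exact (continuous_expNeg.tendsto _).comp (ENNReal.tendsto_nat_tsum f)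

/-! ### Poisson sums -/

/-- The generating function of the Poisson law at `expNeg v`. The value `v = ∞` is allowed and
yields the probability of zero points. -/
theorem tsum_pow_mul_poisson {m : ℝ} (hm : 0 ≤ m) (v : ℝ≥0∞) :
    ∑' n : ℕ, expNeg (n * v) * ENNReal.ofReal (Real.exp (-m) * m ^ n / (n.factorial : ℝ)) =
      expNeg (ENNReal.ofReal m * (1 - expNeg v)) := by
  set r : ℝ := (expNeg v).toReal with hr
  have hr0 : 0 ≤ r := ENNReal.toReal_nonneg
  have hr1 : r ≤ 1 := ENNReal.toReal_mono ENNReal.one_ne_top (expNeg_le_one v)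
  have hv : expNeg v = ENNReal.ofReal r := (ENNReal.ofReal_toReal (expNeg_ne_top v)).symm
  have hs : HasSum (fun n : ℕ => Real.exp (-m) * ((r * m) ^ n / (n.factorial : ℝ)))
      (Real.exp (-m) * Real.exp (r * m)) := by
    have := (NormedSpace.expSeries_div_hasSum_exp (r * m)).mul_left (Real.exp (-m))
    rwa [← Real.exp_eq_exp_ℝ] at this
  calc ∑' n : ℕ, expNeg (n * v) * ENNReal.ofReal (Real.exp (-m) * m ^ n / (n.factorial : ℝ))
      = ∑' n : ℕ, ENNReal.ofReal (Real.exp (-m) * ((r * m) ^ n / (n.factorial : ℝ))) := by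
        refine tsum_congr fun n => ?_
        rw [expNeg_nat_mul, hv, ← ENNReal.ofReal_pow hr0, ← ENNReal.ofReal_mul (by positivity)]
        congr 1
        rw [mul_pow]
        ring
    _ = ENNReal.ofReal (Real.exp (-m) * Real.exp (r * m)) := by
        rw [← ENNReal.ofReal_tsum_of_nonneg (fun n => by positivity) hs.summable, hs.tsum_eq]
    _ = expNeg (ENNReal.ofReal m * (1 - expNeg v)) := by
        rw [hv, ← ENNReal.ofReal_one, ← ENNReal.ofReal_sub _ hr0, ← ENNReal.ofReal_mul hm,
          expNeg_ofReal (mul_nonneg hm (sub_nonneg.2 hr1)), ← Real.exp_add]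
        congr 2
        ring

theorem tsum_poisson {m : ℝ} (hm : 0 ≤ m) :
    ∑' n : ℕ, ENNReal.ofReal (Real.exp (-m) * m ^ n / (n.factorial : ℝ)) = 1 := by
  simpa using tsum_pow_mul_poisson hm 0

theorem tsum_nat_mul_poisson {m : ℝ} (hm : 0 ≤ m) :
    ∑' n : ℕ, (n : ℝ≥0∞) * ENNReal.ofReal (Real.exp (-m) * m ^ n / (n.factorial : ℝ)) =
      ENNReal.ofReal m := by
  rw [tsum_eq_zero_add' ENNReal.summable]
  simp only [Nat.cast_zero, zero_mul, zero_add]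
  have : ∀ n : ℕ, ((n + 1 : ℕ) : ℝ≥0∞) *
      ENNReal.ofReal (Real.exp (-m) * m ^ (n + 1) / ((n + 1).factorial : ℝ)) =
      ENNReal.ofReal m * ENNReal.ofReal (Real.exp (-m) * m ^ n / (n.factorial : ℝ)) := fun n => by
    rw [← ENNReal.ofReal_natCast, ← ENNReal.ofReal_mul (by positivity), ← ENNReal.ofReal_mul hm,
      Nat.factorial_succ]
    congr 1
    push_cast
    field_simp
    ring
  simp only [this]
  rw [ENNReal.tsum_mul_left, tsum_poisson hm, mul_one]

/-! ### Poisson point processes -/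

section PointProcess

/-- The counting measure of the points of a configuration. -/
noncomputable def pointMeasure {Ω : Type*} (X : ℕ → Ω → Plane) (ω : Ω) : Measure Plane :=
  Measure.sum fun i => Measure.dirac (X i ω)

theorem lintegral_pointMeasure {Ω : Type*} {X : ℕ → Ω → Plane} (ω : Ω) {f : Plane → ℝ≥0∞} (hf : Measurable f) :
    ∫⁻ x, f x ∂pointMeasure X ω = ∑' i, f (X i ω) := by
  rw [pointMeasure, lintegral_sum_measure]
  simp only [lintegral_dirac' _ hf]

theorem pointMeasure_apply {Ω : Type*} {X : ℕ → Ω → Plane} (ω : Ω) {B : Set Plane} (hB : MeasurableSet B) :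
    pointMeasure X ω B = (pointCount X B ω : ℝ≥0∞) := by
  have h1 : pointMeasure X ω B = ∑' i, ({i | X i ω ∈ B} : Set ℕ).indicator 1 i := by
    rw [pointMeasure, Measure.sum_apply _ hB]
    refine tsum_congr fun i => ?_
    rw [Measure.dirac_apply' _ hB]
    rfl
  rw [h1, ← tsum_subtype, pointCount, ← ENNReal.tsum_set_one]
  rfl

variable {Ω : Type*} [MeasurableSpace Ω] {μ : Measure Ω} {X : ℕ → Ω → Plane} {lam : ℝ}

theorem IsHPPP.measurable_pointCount (h : IsHPPP μ X lam) {B : Set Plane} (hB : MeasurableSet B) :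
    Measurable fun ω => (pointCount X B ω : ℝ≥0∞) := by
  simp only [← pointMeasure_apply _ hB]
  have : (fun ω => pointMeasure X ω B) = fun ω => ∑' i, B.indicator 1 (X i ω) := by
    funext ω
    rw [pointMeasure, Measure.sum_apply _ hB]
    exact tsum_congr fun i => Measure.dirac_apply' _ hB
  rw [this]
  exact Measurable.tsum fun i => (measurable_one.indicator hB).comp (h.measurable i)

variable [IsProbabilityMeasure μ]

/-- The Poisson weights of the finite counts already sum to one. -/
theorem IsHPPP.ae_pointCount_ne_top (h : IsHPPP μ X lam) (hlam : 0 ≤ lam) {B : Set Plane}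
    (hB : MeasurableSet B) (hb : Bornology.IsBounded B) :
    ∀ᵐ ω ∂μ, pointCount X B ω ≠ ⊤ := by
  have hm : ∀ n : ℕ, MeasurableSet {ω | pointCount X B ω = n} := fun n => by
    have := h.measurable_pointCount hB (measurableSet_singleton (n : ℝ≥0∞))
    refine (congrArg MeasurableSet (Set.ext fun ω => ?_)).mp this
    simp only [mem_preimage, mem_singleton_iff, mem_ofPred_eq]
    norm_cast
  have h1 : μ (⋃ n : ℕ, {ω | pointCount X B ω = n}) = 1 := by
    rw [measure_iUnion (fun i j hij => Set.disjoint_left.2 fun ω h1 h2 => hij ?_) hm]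
    · simp only [h.count_law B hB hb]
      exact tsum_poisson (by positivity)
    · exact_mod_cast (h1 : _ = _).symm.trans h2
  have h2 := (prob_compl_eq_zero_iff (MeasurableSet.iUnion hm)).2 h1
  refine measure_mono_null (fun ω hω => ?_) h2
  have hω : pointCount X B ω = ⊤ := not_not.1 hω
  simp [hω]

/-- Expectation of a function of the number of points in a bounded set. -/
theorem IsHPPP.lintegral_comp_pointCount (h : IsHPPP μ X lam) (hlam : 0 ≤ lam) {B : Set Plane}
    (hB : MeasurableSet B) (hb : Bornology.IsBounded B) (f : ℝ≥0∞ → ℝ≥0∞) :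
    ∫⁻ ω, f (pointCount X B ω) ∂μ = ∑' n : ℕ, f n *
      ENNReal.ofReal (Real.exp (-(lam * volume.real B)) * (lam * volume.real B) ^ n
        / (n.factorial : ℝ)) := by
  have hae := h.ae_pointCount_ne_top hlam hB hb
  -- `toNat` sends `⊤` to `0`, which alters the count on a null set only.
  set K : Ω → ℕ := fun ω => (pointCount X B ω).toNat with hK
  have hKm : Measurable K := by
    have h1 : Measurable fun ω => ((pointCount X B ω : ℝ≥0∞)).toReal :=
      (h.measurable_pointCount hB).ennreal_toReal
    have h2 : K = fun ω => ⌊((pointCount X B ω : ℝ≥0∞)).toReal⌋₊ := by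
      funext ω
      rw [hK]
      cases hc : pointCount X B ω with
      | top => simp [hc]
      | coe n => simp [hc]
    rw [h2]
    exact Nat.measurable_floor.comp h1
  have h1 : ∫⁻ ω, f (pointCount X B ω) ∂μ = ∫⁻ ω, (fun n : ℕ => f n) (K ω) ∂μ := by
    refine lintegral_congr_ae ?_
    filter_upwards [hae] with ω hω
    rw [hK]
    congr 1
    lift pointCount X B ω to ℕ using hω with n
    simp
  have h2 : ∫⁻ n : ℕ, f n ∂(μ.map K) = ∫⁻ ω, (fun n : ℕ => f n) (K ω) ∂μ :=
    lintegral_map (measurable_of_countable _) hKm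
  rw [h1, ← h2, lintegral_countable']
  refine tsum_congr fun n => ?_
  rw [Measure.map_apply hKm (measurableSet_singleton n), ← h.count_law B hB hb n]
  congr 1
  refine measure_congr ?_
  filter_upwards [hae] with ω hω
  refine propext ?_
  change K ω = n ↔ pointCount X B ω = n
  rw [hK]
  dsimp only
  lift pointCount X B ω to ℕ using hω with k
  simp

theorem IsHPPP.lintegral_pointCount (h : IsHPPP μ X lam) (hlam : 0 ≤ lam) {B : Set Plane}
    (hB : MeasurableSet B) (hb : Bornology.IsBounded B) :
    ∫⁻ ω, pointCount X B ω ∂μ = ENNReal.ofReal lam * volume B := by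
  rw [h.lintegral_comp_pointCount hlam hB hb fun x => x, tsum_nat_mul_poisson (by positivity),
    ENNReal.ofReal_mul hlam, ofReal_measureReal hb.measure_lt_top.ne]

theorem IsHPPP.lintegral_expNeg_pointCount (h : IsHPPP μ X lam) (hlam : 0 ≤ lam) {B : Set Plane}
    (hB : MeasurableSet B) (hb : Bornology.IsBounded B) (v : ℝ≥0∞) :
    ∫⁻ ω, expNeg (v * pointCount X B ω) ∂μ =
      expNeg (ENNReal.ofReal lam * ((1 - expNeg v) * volume B)) := by
  rw [h.lintegral_comp_pointCount hlam hB hb fun x => expNeg (v * x)]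
  simp only [mul_comm v]
  rw [tsum_pow_mul_poisson (by positivity), ENNReal.ofReal_mul hlam,
    ofReal_measureReal hb.measure_lt_top.ne]
  congr 1
  ring

/-- Campbell's formula: the intensity measure of the point process is `lam` times area. -/
theorem IsHPPP.sum_map_eq (h : IsHPPP μ X lam) (hlam : 0 ≤ lam) :
    Measure.sum (fun i => μ.map (X i)) = ENNReal.ofReal lam • volume := by
  -- The count laws concern bounded sets only, so the measures are compared inside balls that
  -- exhaust the plane.
  refine Measure.ext_of_iUnion_eq_univ (s := fun n : ℕ => Metric.ball (0 : Plane) n)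
    (Metric.iUnion_ball_nat 0) fun n => ?_
  ext B hB
  have hB' : MeasurableSet (B ∩ Metric.ball (0 : Plane) n) := hB.inter measurableSet_ball
  rw [Measure.restrict_apply hB, Measure.restrict_apply hB, Measure.smul_apply, smul_eq_mul,
    ← h.lintegral_pointCount hlam hB' (Metric.isBounded_ball.subset inter_subset_right),
    Measure.sum_apply _ hB']
  simp only [← pointMeasure_apply _ hB', pointMeasure, Measure.sum_apply _ hB',
    Measure.dirac_apply' _ hB']
  refine Eq.trans (tsum_congr fun i => ?_) (lintegral_tsum fun i =>
    ((measurable_one.indicator hB').comp (h.measurable i)).aemeasurable).symm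
  rw [Measure.map_apply (h.measurable i) hB',
    ← lintegral_indicator_one ((h.measurable i) hB')]
  rfl

theorem IsHPPP.lintegral_tsum (h : IsHPPP μ X lam) (hlam : 0 ≤ lam) {f : Plane → ℝ≥0∞}
    (hf : Measurable f) :
    ∫⁻ ω, ∑' i, f (X i ω) ∂μ = ENNReal.ofReal lam * ∫⁻ x, f x := by
  refine (MeasureTheory.lintegral_tsum fun i =>
    (hf.comp (h.measurable i)).aemeasurable).trans ?_
  rw [← smul_eq_mul, ← lintegral_smul_measure, ← h.sum_map_eq hlam, lintegral_sum_measure]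
  exact tsum_congr fun i => (lintegral_map hf (h.measurable i)).symm

/-- The sum over the points is a linear combination of the counts in the nonzero level sets, which
are independent Poisson variables. The level set of zero is unbounded and has to be left out; it
contributes nothing. -/
theorem IsHPPP.laplace_simpleFunc (h : IsHPPP μ X lam) (hlam : 0 ≤ lam)
    (f : SimpleFunc Plane ℝ≥0∞) (hb : Bornology.IsBounded (Function.support f)) :
    ∫⁻ ω, expNeg (∑' i, f (X i ω)) ∂μ =
      expNeg (ENNReal.ofReal lam * ∫⁻ x, (1 - expNeg (f x))) := by
  classical
  set s := f.range.filter (· ≠ 0) with hs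
  set e := s.equivFin.symm with he
  set B : Fin s.card → Set Plane := fun j => f ⁻¹' {(e j : ℝ≥0∞)} with hB
  have hBm : ∀ j, MeasurableSet (B j) := fun j => f.measurableSet_preimage _
  have hBb : ∀ j, Bornology.IsBounded (B j) := fun j => hb.subset fun x hx => by
    have h1 : f x = e j := hx
    have h2 := (Finset.mem_filter.1 (e j).2).2
    rw [Function.mem_support, h1]
    exact h2
  have hBd : Pairwise (Disjoint on B) := fun i j hij => Set.disjoint_left.2 fun x h1 h2 => by
    refine hij (e.injective (Subtype.ext ?_))
    exact (h1 : f x = e i).symm.trans h2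
  have hsum : ∀ g : ℝ≥0∞ → ℝ≥0∞, g 0 = 0 →
      ∑ v ∈ f.range, g v = ∑ j, g (e j) := fun g hg => by
    rw [Equiv.sum_comp e (fun v => g v), Finset.sum_coe_sort s g, hs, Finset.sum_filter]
    refine Finset.sum_congr rfl fun v _ => ?_
    split_ifs with hv
    · rfl
    · rw [not_not.1 hv, hg]
  have h1 : ∀ ω, ∑' i, f (X i ω) = ∑ j, (e j : ℝ≥0∞) * pointCount X (B j) ω := fun ω => by
    rw [← lintegral_pointMeasure ω f.measurable, SimpleFunc.lintegral_eq_lintegral,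
      SimpleFunc.lintegral, hsum (fun v => v * pointMeasure X ω (f ⁻¹' {v})) (by simp)]
    exact Finset.sum_congr rfl fun j _ => by rw [pointMeasure_apply ω (hBm j)]
  have h2 : ∫⁻ x, (1 - expNeg (f x)) = ∑ j, (1 - expNeg (e j : ℝ≥0∞)) * volume (B j) := by
    rw [← hsum (fun v => (1 - expNeg v) * volume (f ⁻¹' {v})) (by simp),
      ← SimpleFunc.map_lintegral, ← SimpleFunc.lintegral_eq_lintegral]
    rfl
  have hind := (h.indep _ B hBm hBb hBd).comp
    (fun j (n : ℕ∞) => expNeg ((e j : ℝ≥0∞) * (n : ℝ≥0∞))) fun j => by fun_prop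
  simp only [h1, expNeg_sum]
  have h3 := lintegral_prod_eq_prod_lintegral_of_indepFun Finset.univ _ hind fun j =>
    (measurable_expNeg.comp ((h.measurable_pointCount (hBm j)).const_mul _))
  refine h3.trans ?_
  rw [h2, Finset.mul_sum, expNeg_sum]
  exact Finset.prod_congr rfl fun j _ => h.lintegral_expNeg_pointCount hlam (hBm j) (hBb j) _

/-- The Laplace functional of a homogeneous Poisson point process. -/
theorem IsHPPP.laplace (h : IsHPPP μ X lam) (hlam : 0 ≤ lam) {f : Plane → ℝ≥0∞}
    (hf : Measurable f) :
    ∫⁻ ω, expNeg (∑' i, f (X i ω)) ∂μ =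
      expNeg (ENNReal.ofReal lam * ∫⁻ x, (1 - expNeg (f x))) := by
  -- Simple functions cut to growing balls increase to `f`. The expectation converges by domination
  -- by one, the exponent on the right by monotone convergence.
  set g : ℕ → SimpleFunc Plane ℝ≥0∞ := fun n =>
    (SimpleFunc.eapprox f n).restrict (Metric.ball 0 n) with hg
  have hga : ∀ n x, g n x = (Metric.ball (0 : Plane) n).indicator (SimpleFunc.eapprox f n) x :=
    fun n x => SimpleFunc.restrict_apply _ measurableSet_ball x
  have hgmono : ∀ x, Monotone fun n => g n x := fun x m n hmn => by
    simp only [hga]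
    refine indicator_le_indicator_of_subset (Metric.ball_subset_ball (by exact_mod_cast hmn))
      (fun _ => bot_le) x |>.trans (indicator_le_indicator ?_)
    exact SimpleFunc.monotone_eapprox f hmn x
  have hgt : ∀ x, Filter.Tendsto (fun n => g n x) Filter.atTop (nhds (f x)) := fun x => by
    refine (SimpleFunc.tendsto_eapprox hf x).congr' ?_
    obtain ⟨N, hN⟩ := exists_nat_gt ‖x‖
    filter_upwards [Filter.eventually_ge_atTop N] with n hn
    rw [hga, indicator_of_mem]
    rw [mem_ball_zero_iff]
    exact hN.trans_le (by exact_mod_cast hn)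
  have hgb : ∀ n, Bornology.IsBounded (Function.support (g n)) := fun n =>
    (Metric.isBounded_ball (x := (0 : Plane)) (r := n)).subset fun x hx => by
      by_contra hc
      refine hx ?_
      rw [hga, indicator_of_notMem hc]
  have hleft : Filter.Tendsto (fun n => ∫⁻ ω, expNeg (∑' i, g n (X i ω)) ∂μ) Filter.atTop
      (nhds (∫⁻ ω, expNeg (∑' i, f (X i ω)) ∂μ)) := by
    refine tendsto_lintegral_of_dominated_convergence (fun _ => 1) (fun n => ?_)
      (fun n => Filter.Eventually.of_forall fun ω => expNeg_le_one _) (by simp)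
      (Filter.Eventually.of_forall fun ω => (continuous_expNeg.tendsto _).comp ?_)
    · exact measurable_expNeg.comp (Measurable.tsum fun i => (g n).measurable.comp (h.measurable i))
    · simp only [← lintegral_pointMeasure ω hf, ← lintegral_pointMeasure ω (g _).measurable]
      exact lintegral_tendsto_of_tendsto_of_monotone (fun n => (g n).measurable.aemeasurable)
        (Filter.Eventually.of_forall hgmono) (Filter.Eventually.of_forall hgt)
  have hright : Filter.Tendsto
      (fun n => expNeg (ENNReal.ofReal lam * ∫⁻ x, (1 - expNeg (g n x)))) Filter.atTop
      (nhds (expNeg (ENNReal.ofReal lam * ∫⁻ x, (1 - expNeg (f x))))) := by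
    refine (continuous_expNeg.tendsto _).comp
      (ENNReal.Tendsto.const_mul ?_ (Or.inr ENNReal.ofReal_ne_top))
    refine lintegral_tendsto_of_tendsto_of_monotone (fun n => ?_)
      (Filter.Eventually.of_forall fun x m n hmn =>
        tsub_le_tsub_left (expNeg_antitone (hgmono x hmn)) 1)
      (Filter.Eventually.of_forall fun x => ?_)
    · exact (measurable_const.sub (measurable_expNeg.comp (g n).measurable)).aemeasurable
    · exact ENNReal.Tendsto.sub tendsto_const_nhds ((continuous_expNeg.tendsto _).comp (hgt x))
        (Or.inl ENNReal.one_ne_top)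
  refine tendsto_nhds_unique hleft (hright.congr fun n => ?_)
  exact (h.laplace_simpleFunc hlam (g n) (hgb n)).symm

/-! ### The squared distances form a Poisson process of rate one on the half line -/

/-- Mean number of points that are closer to the origin than `x`. -/
noncomputable def discMean (lam : ℝ) (x : Plane) : ℝ := lam * Real.pi * ‖x‖ ^ 2

@[fun_prop]
theorem measurable_discMean (lam : ℝ) : Measurable (discMean lam) := by
  unfold discMean
  fun_prop

/-- For `b ≥ 0` the disc `discMean lam x < b` has area `b / lam`, hence intensity `b`; differences
of discs are the preimages of half-open intervals. -/
theorem map_discMean {lam : ℝ} (hlam : 0 < lam) :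
    (ENNReal.ofReal lam • volume).map (discMean lam) = volume.restrict (Ioi 0) := by
  have hpi := Real.pi_pos
  have hc : 0 < lam * Real.pi := by positivity
  have key : ∀ b : ℝ, (ENNReal.ofReal lam • volume) {x : Plane | discMean lam x < b} =
      ENNReal.ofReal b := fun b => by
    have h1 : {x : Plane | discMean lam x < b} = Metric.ball 0 √(b / (lam * Real.pi)) := by
      ext x
      rw [mem_ball_zero_iff, Real.lt_sqrt (norm_nonneg x), lt_div_iff₀ hc, mul_comm]
      rfl
    rw [h1, Measure.smul_apply, EuclideanSpace.volume_ball_fin_two, smul_eq_mul,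
      ← ENNReal.ofReal_pow (Real.sqrt_nonneg _), ← ENNReal.ofReal_mul (by positivity),
      ← ENNReal.ofReal_mul hlam.le]
    rcases le_or_gt 0 b with hb | hb
    · rw [Real.sq_sqrt (by positivity)]
      congr 1
      field_simp
    · rw [Real.sqrt_eq_zero_of_nonpos (div_nonpos_of_nonpos_of_nonneg hb.le hc.le),
        ENNReal.ofReal_of_nonpos hb.le]
      simp
  symm
  refine Measure.ext_of_Ico _ _ fun a b hab => ?_
  rw [Measure.map_apply (measurable_discMean lam) measurableSet_Ico]
  have h1 : discMean lam ⁻¹' Ico a b =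
      {x | discMean lam x < b} \ {x | discMean lam x < a} := by
    ext x
    simp [and_comm]
  have hm : ∀ c : ℝ, MeasurableSet {x : Plane | discMean lam x < c} := fun c =>
    (measurable_discMean lam) measurableSet_Iio
  have hsub : {x : Plane | discMean lam x < a} ⊆ {x | discMean lam x < b} :=
    fun x hx => lt_trans (show discMean lam x < a from hx) hab
  rw [h1, measure_sdiff hsub (hm a).nullMeasurableSet
    (by rw [key]; exact ENNReal.ofReal_ne_top), key, key, Measure.restrict_congr_set
    (Ioi_ae_eq_Ici), Measure.restrict_apply measurableSet_Ico]
  have h2 : Ico a b ∩ Ici 0 = Ico (max a 0) b := by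
    ext x
    simp only [mem_inter_iff, mem_Ico, mem_Ici, max_le_iff]
    tauto
  rw [h2, Real.volume_Ico]
  rcases le_total a 0 with ha | ha
  · rw [max_eq_right ha, sub_zero, ENNReal.ofReal_of_nonpos ha, tsub_zero]
  · rw [max_eq_left ha, ENNReal.ofReal_sub _ ha]

theorem lintegral_discMean {lam : ℝ} (hlam : 0 < lam) {f : ℝ → ℝ≥0∞} (hf : Measurable f) :
    ENNReal.ofReal lam * ∫⁻ x : Plane, f (discMean lam x) = ∫⁻ t in Ioi 0, f t := by
  rw [← map_discMean hlam, lintegral_map hf (measurable_discMean lam), lintegral_smul_measure,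
    smul_eq_mul]

theorem IsHPPP.laplace_discMean (h : IsHPPP μ X lam) (hlam : 0 < lam) {f : ℝ → ℝ≥0∞}
    (hf : Measurable f) :
    ∫⁻ ω, expNeg (∑' i, f (discMean lam (X i ω))) ∂μ =
      expNeg (∫⁻ t in Ioi 0, (1 - expNeg (f t))) := by
  rw [← lintegral_discMean hlam (by fun_prop)]
  exact h.laplace hlam.le (hf.comp (measurable_discMean lam))

theorem IsHPPP.lintegral_tsum_discMean (h : IsHPPP μ X lam) (hlam : 0 < lam) {f : ℝ → ℝ≥0∞}
    (hf : Measurable f) :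
    ∫⁻ ω, ∑' i, f (discMean lam (X i ω)) ∂μ = ∫⁻ t in Ioi 0, f t := by
  rw [← lintegral_discMean hlam hf]
  exact h.lintegral_tsum hlam.le (hf.comp (measurable_discMean lam))

end PointProcess

/-! ### Functionals of a Poisson process seen from its first point -/

section FirstPoint

/-- The functional `φ` of `x / s`, with the value `∞` at the points `s` before `w`. -/
noncomputable def voidLoss (L : ℝ → ℝ≥0∞) (x w s : ℝ) : ℝ≥0∞ := if s < w then ⊤ else L (x / s)

variable {L : ℝ → ℝ≥0∞}

theorem measurable_voidLoss (hL : Measurable L) (x w : ℝ) : Measurable (voidLoss L x w) :=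
  Measurable.ite measurableSet_Iio measurable_const (hL.comp (by fun_prop))

/-- Substitution `s = t u`. As the loss depends only on the ratio to the first point, its total cost
is linear in `t`. -/
theorem lintegral_scale {f : ℝ → ℝ≥0∞} (hf : Measurable f) {t : ℝ} (ht : 0 < t) :
    ∫⁻ s in Ici t, f (t / s) = ENNReal.ofReal t * ∫⁻ s in Ioi 1, f (1 / s) := by
  have h1 : ∫⁻ s, (Ici t).indicator (fun s => f (t / s)) s =
      ∫⁻ s, (Ici t).indicator (fun s => f (t / s)) s
        ∂(ENNReal.ofReal |t| • Measure.map (t * ·) volume) := by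
    rw [Real.smul_map_volume_mul_left ht.ne']
  rw [← lintegral_indicator measurableSet_Ici, h1,
    lintegral_smul_measure, lintegral_map (Measurable.indicator (by fun_prop) measurableSet_Ici)
      (by fun_prop), abs_of_pos ht, smul_eq_mul, Measure.restrict_congr_set Ioi_ae_eq_Ici,
    ← lintegral_indicator measurableSet_Ici]
  congr 2
  funext s
  simp only [indicator, mem_Ici, le_mul_iff_one_le_right ht]
  congr 2
  field_simp

/-- An infinite loss costs one per unit length, so the void before `w` contributes `w`. -/
theorem lintegral_voidLoss (x : ℝ) {w : ℝ} (hw : 0 < w) :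
    ∫⁻ s in Ioi 0, (1 - expNeg (voidLoss L x w s)) =
      ENNReal.ofReal w + ∫⁻ s in Ici w, (1 - expNeg (L (x / s))) := by
  have h : Ioi (0 : ℝ) = Ioo 0 w ∪ Ici w := (Ioo_union_Ici_eq_Ioi hw).symm
  rw [h, lintegral_union measurableSet_Ici
    (Set.disjoint_left.2 fun s hs hs' => absurd hs.2 (not_lt.2 hs'))]
  congr 1
  · rw [setLIntegral_congr_fun (g := fun _ => 1) measurableSet_Ioo fun s hs => ?_]
    · simp
    · simp [voidLoss, hs.2]
  · refine setLIntegral_congr_fun measurableSet_Ici fun s hs => ?_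
    simp only [voidLoss, if_neg (not_lt.2 (mem_Ici.1 hs))]

variable {c : ℝ} (hC : ∫⁻ s in Ioi 1, (1 - expNeg (L (1 / s))) = ENNReal.ofReal c)

include hC in
theorem lintegral_voidLoss_self (hL : Measurable L) (hc : 0 ≤ c) {t : ℝ} (ht : 0 < t) :
    ∫⁻ s in Ioi 0, (1 - expNeg (voidLoss L t t s)) = ENNReal.ofReal ((1 + c) * t) := by
  rw [lintegral_voidLoss t ht, lintegral_scale (f := fun u => 1 - expNeg (L u)) (by fun_prop) ht,
    hC, ← ENNReal.ofReal_mul ht.le, ← ENNReal.ofReal_add ht.le (by positivity)]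
  congr 1
  ring

/-- Extending the void from `t` to `t + d` replaces `1 - exp (-L)` by `1` on the window, an increase
of `exp (-L)`. The additive form avoids truncated subtraction. -/
theorem lintegral_voidLoss_add (hL : Measurable L) {t d : ℝ} (ht : 0 < t) (hd : 0 < d) :
    ∫⁻ s in Ioi 0, (1 - expNeg (voidLoss L t (t + d) s)) =
      (∫⁻ s in Ioi 0, (1 - expNeg (voidLoss L t t s))) +
        ∫⁻ s in Ico t (t + d), expNeg (L (t / s)) := by
  rw [lintegral_voidLoss t ht, lintegral_voidLoss t (by positivity)]
  have h : Ici t = Ico t (t + d) ∪ Ici (t + d) := (Ico_union_Ici_eq_Ici (by linarith)).symm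
  rw [h, lintegral_union measurableSet_Ici
    (Set.disjoint_left.2 fun s hs hs' => absurd hs.2 (not_lt.2 hs'))]
  have h1 : (∫⁻ s in Ico t (t + d), (1 - expNeg (L (t / s)))) +
      ∫⁻ s in Ico t (t + d), expNeg (L (t / s)) = ENNReal.ofReal d := by
    rw [← lintegral_add_left (by fun_prop)]
    simp only [tsub_add_cancel_of_le (expNeg_le_one _)]
    simp
  rw [ENNReal.ofReal_add ht.le hd.le, ← h1]
  ring

theorem one_sub_expNeg_le (x : ℝ≥0∞) : 1 - expNeg x ≤ x := by
  rcases eq_or_ne x ⊤ with rfl | hx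
  · exact le_top
  · have h0 := ENNReal.toReal_nonneg (a := x)
    rw [← ENNReal.ofReal_toReal hx, expNeg_ofReal h0, ← ENNReal.ofReal_one,
      ← ENNReal.ofReal_sub _ (Real.exp_pos _).le]
    refine ENNReal.ofReal_le_ofReal ?_
    have := Real.add_one_le_exp (-x.toReal)
    linarith

theorem ofReal_div_le_one_sub_expNeg {x : ℝ} (hx : 0 ≤ x) :
    ENNReal.ofReal (x / (1 + x)) ≤ 1 - expNeg (ENNReal.ofReal x) := by
  rw [expNeg_ofReal hx, ← ENNReal.ofReal_one, ← ENNReal.ofReal_sub _ (Real.exp_pos _).le]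
  refine ENNReal.ofReal_le_ofReal ?_
  rw [Real.exp_neg, div_le_iff₀ (by positivity)]
  have h1 := Real.add_one_le_exp x
  have h2 : (Real.exp x)⁻¹ * (1 + x) ≤ 1 := by
    rw [inv_mul_le_iff₀ (Real.exp_pos x)]
    linarith
  linarith

/-- For a short window of length `d` the integral is `d exp (-L 1)` to first order. Below, `L (t /
s) ≤ L 1` and `x / (1 + x) ≤ 1 - e^{-x}` are used; above, the value of `L` at the right end of the
window and `1 - e^{-x} ≤ x`. -/
theorem tendsto_window_rate (hLmono : MonotoneOn L (Ioi 0))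
    (hLcont : ContinuousOn L (Ioi 0)) {t : ℝ} (ht : 0 < t) :
    Filter.Tendsto (fun n : ℕ => ((n : ℝ≥0∞) + 1) *
      (1 - expNeg (∫⁻ s in Ico t (t + 1 / ((n : ℝ) + 1)), expNeg (L (t / s))))) Filter.atTop
      (nhds (expNeg (L 1))) := by
  set r : ℝ := (expNeg (L 1)).toReal with hr
  have hr0 : 0 ≤ r := ENNReal.toReal_nonneg
  have hv : expNeg (L 1) = ENNReal.ofReal r := (ENNReal.ofReal_toReal (expNeg_ne_top _)).symm
  have hn : ∀ n : ℕ, ((n : ℝ≥0∞) + 1) = ENNReal.ofReal ((n : ℝ) + 1) := fun n => by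
    rw [ENNReal.ofReal_add (by positivity) zero_le_one]
    simp
  have hvol : ∀ n : ℕ, volume (Ico t (t + 1 / ((n : ℝ) + 1))) =
      ENNReal.ofReal (1 / ((n : ℝ) + 1)) := fun n => by
    rw [Real.volume_Ico, add_sub_cancel_left]
  have hlow : Filter.Tendsto (fun n : ℕ => ENNReal.ofReal (r / (1 + r * (1 / ((n : ℝ) + 1)))))
      Filter.atTop (nhds (expNeg (L 1))) := by
    rw [hv]
    refine (ENNReal.continuous_ofReal.tendsto _).comp ?_
    have h1 : Filter.Tendsto (fun n : ℕ => 1 + r * (1 / ((n : ℝ) + 1))) Filter.atTop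
        (nhds (1 + r * 0)) := (tendsto_one_div_add_atTop_nhds_zero_nat.const_mul r).const_add 1
    have h2 := (tendsto_const_nhds (x := r)).div h1 (by simp)
    rw [mul_zero, add_zero, div_one] at h2
    exact h2
  have hup : Filter.Tendsto (fun n : ℕ => expNeg (L (t / (t + 1 / ((n : ℝ) + 1)))))
      Filter.atTop (nhds (expNeg (L 1))) := by
    refine (continuous_expNeg.tendsto _).comp ?_
    have h1 : Filter.Tendsto (fun n : ℕ => t + 1 / ((n : ℝ) + 1)) Filter.atTop
        (nhds (t + 0)) := tendsto_one_div_add_atTop_nhds_zero_nat.const_add t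
    have h2 := (tendsto_const_nhds (x := t)).div h1 (by simpa using ht.ne')
    rw [add_zero, div_self ht.ne'] at h2
    exact (hLcont.continuousAt (Ioi_mem_nhds one_pos)).tendsto.comp h2
  refine tendsto_of_tendsto_of_tendsto_of_le_of_le hlow hup (fun n => ?_) (fun n => ?_)
  · have hd : 0 < 1 / ((n : ℝ) + 1) := by positivity
    have h1 : ENNReal.ofReal (r * (1 / ((n : ℝ) + 1))) ≤
        ∫⁻ s in Ico t (t + 1 / ((n : ℝ) + 1)), expNeg (L (t / s)) := by
      rw [ENNReal.ofReal_mul hr0, ← hv, ← hvol n, ← setLIntegral_const]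
      refine setLIntegral_mono' measurableSet_Ico fun s hs => expNeg_antitone ?_
      have hs0 : 0 < s := ht.trans_le hs.1
      exact hLmono (mem_Ioi.2 (div_pos ht hs0)) (mem_Ioi.2 one_pos) ((div_le_one hs0).2 hs.1)
    calc ENNReal.ofReal (r / (1 + r * (1 / ((n : ℝ) + 1))))
        = ((n : ℝ≥0∞) + 1) * ENNReal.ofReal
            (r * (1 / ((n : ℝ) + 1)) / (1 + r * (1 / ((n : ℝ) + 1)))) := by
          rw [hn, ← ENNReal.ofReal_mul (by positivity)]
          congr 1
          field_simp
      _ ≤ _ := by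
          gcongr
          exact (ofReal_div_le_one_sub_expNeg (by positivity)).trans
            (tsub_le_tsub_left (expNeg_antitone h1) 1)
  · have hd : 0 < 1 / ((n : ℝ) + 1) := by positivity
    have h1 : ∫⁻ s in Ico t (t + 1 / ((n : ℝ) + 1)), expNeg (L (t / s)) ≤
        expNeg (L (t / (t + 1 / ((n : ℝ) + 1)))) * ENNReal.ofReal (1 / ((n : ℝ) + 1)) := by
      rw [← hvol n, ← setLIntegral_const]
      refine setLIntegral_mono' measurableSet_Ico fun s hs => expNeg_antitone ?_
      have hs0 : 0 < s := ht.trans_le hs.1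
      exact hLmono (div_pos ht (by positivity)) (div_pos ht hs0)
        (div_le_div_of_nonneg_left ht.le hs0 hs.2.le)
    calc _ ≤ ((n : ℝ≥0∞) + 1) * (expNeg (L (t / (t + 1 / ((n : ℝ) + 1)))) *
            ENNReal.ofReal (1 / ((n : ℝ) + 1))) := by
          gcongr
          exact (one_sub_expNeg_le _).trans h1
      _ = _ := by
          rw [mul_left_comm, hn, ← ENNReal.ofReal_mul (by positivity), mul_one_div_cancel
            (by positivity), ENNReal.ofReal_one, mul_one]

theorem lintegral_expNeg_mul {b : ℝ} (hb : 0 < b) :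
    ∫⁻ t in Ioi 0, expNeg (ENNReal.ofReal (b * t)) = ENNReal.ofReal (1 / b) := by
  have h1 : ∫⁻ t in Ioi 0, expNeg (ENNReal.ofReal (b * t)) =
      ∫⁻ t in Ioi 0, ENNReal.ofReal (Real.exp (-b * t)) :=
    setLIntegral_congr_fun measurableSet_Ioi fun t ht => by
      have ht : 0 < t := ht
      simp only [expNeg_ofReal (by positivity : 0 ≤ b * t), neg_mul]
  rw [h1, ← ofReal_integral_eq_lintegral_ofReal (integrableOn_exp_mul_Ioi (by linarith) 0)
    (Filter.Eventually.of_forall fun t => (Real.exp_pos _).le),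
    integral_exp_mul_Ioi (by linarith)]
  simp [neg_div_neg_eq]

/-- The sum of the losses with respect to the first point is approximated from below. -/
theorem tendsto_tsum_left (hLmono : MonotoneOn L (Ioi 0)) (hLcont : ContinuousOn L (Ioi 0))
    {T : ℕ → ℝ} (hT : ∀ i, 0 < T i) {t : ℝ} (ht : 0 < t) :
    Filter.Tendsto (fun n : ℕ => ∑' i, L ((t - min (t / 2) (1 / ((n : ℝ) + 1))) / T i))
      Filter.atTop (nhds (∑' i, L (t / T i))) := by
  -- The cap `t / 2` keeps the argument positive. Approaching `t` from below makes the sums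
  -- increase, so monotone convergence applies even to an infinite limit.
  have hpos : ∀ n : ℕ, 0 < t - min (t / 2) (1 / ((n : ℝ) + 1)) := fun n => by
    have := min_le_left (t / 2) (1 / ((n : ℝ) + 1))
    linarith
  have h0 : Filter.Tendsto (fun n : ℕ => t - min (t / 2) (1 / ((n : ℝ) + 1))) Filter.atTop
      (nhds t) := by
    have h1 := (tendsto_const_nhds (x := t)).sub
      ((tendsto_const_nhds (x := t / 2)).min tendsto_one_div_add_atTop_nhds_zero_nat)
    rwa [min_eq_right (by positivity), sub_zero] at h1
  simp only [← lintegral_count]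
  refine lintegral_tendsto_of_tendsto_of_monotone (fun n => (measurable_of_countable _).aemeasurable)
    (Filter.Eventually.of_forall fun i m n hmn => ?_) (Filter.Eventually.of_forall fun i => ?_)
  · refine hLmono (div_pos (hpos m) (hT i)) (div_pos (hpos n) (hT i))
      (div_le_div_of_nonneg_right ?_ (hT i).le)
    gcongr
  · exact (hLcont.continuousAt (Ioi_mem_nhds (div_pos ht (hT i)))).tendsto.comp
      (h0.div_const (T i))

variable {Ω : Type*}

theorem expNeg_tsum_voidLoss_of_le {T : ℕ → ℝ} {w : ℝ} (h : ∀ i, w ≤ T i) (x : ℝ) :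
    expNeg (∑' i, voidLoss L x w (T i)) = expNeg (∑' i, L (x / T i)) := by
  simp only [voidLoss, if_neg (not_lt.2 (h _))]

theorem expNeg_tsum_voidLoss_of_lt {T : ℕ → ℝ} {w : ℝ} {i : ℕ} (h : T i < w) (x : ℝ) :
    expNeg (∑' i, voidLoss L x w (T i)) = 0 := by
  rw [ENNReal.tsum_eq_top_of_eq_top ⟨i, if_pos h⟩, expNeg_top]

/-- If `t + d ≤ T o`, both voids are free of points and the terms cancel; if `t > T o`, both terms
vanish. In between only the first term survives. Integrating over `t` and dividing by `d` thus
averages over a window that ends at the first point. -/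
theorem window_eq {T : ℕ → ℝ} {o : ℕ} (ho : ∀ j, T o ≤ T j) {d : ℝ} (hd : 0 < d) (t : ℝ) :
    expNeg (∑' i, voidLoss L t t (T i)) - expNeg (∑' i, voidLoss L t (t + d) (T i)) =
      (Ioc (T o - d) (T o)).indicator (fun t => expNeg (∑' i, L (t / T i))) t := by
  rcases le_or_gt t (T o - d) with h1 | h1
  · rw [indicator_of_notMem fun h => absurd h.1 (not_lt.2 h1),
      expNeg_tsum_voidLoss_of_le fun i => (by linarith [ho i]),
      expNeg_tsum_voidLoss_of_le fun i => (by linarith [ho i]), tsub_self]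
  · rw [expNeg_tsum_voidLoss_of_lt (i := o) (by linarith : T o < t + d), tsub_zero]
    rcases le_or_gt t (T o) with h2 | h2
    · rw [indicator_of_mem (show t ∈ Ioc (T o - d) (T o) from ⟨h1, h2⟩), expNeg_tsum_voidLoss_of_le fun i => h2.trans (ho i)]
    · rw [indicator_of_notMem fun h => absurd h.2 (not_le.2 h2),
        expNeg_tsum_voidLoss_of_lt (i := o) h2]

theorem window_le_one {T : ℕ → ℝ} {o : ℕ} (ho : ∀ j, T o ≤ T j) (n : ℕ) :
    ((n : ℝ≥0∞) + 1) * ∫⁻ t in Ioi 0, (expNeg (∑' i, voidLoss L t t (T i)) -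
      expNeg (∑' i, voidLoss L t (t + 1 / ((n : ℝ) + 1)) (T i))) ≤ 1 := by
  have hd : 0 < 1 / ((n : ℝ) + 1) := by positivity
  simp only [window_eq ho hd]
  calc _ ≤ ((n : ℝ≥0∞) + 1) * ∫⁻ t, (Ioc (T o - 1 / ((n : ℝ) + 1)) (T o)).indicator 1 t := by
        refine mul_le_mul' le_rfl ?_
        refine (setLIntegral_le_lintegral _ _).trans (lintegral_mono fun t => ?_)
        exact indicator_le_indicator (expNeg_le_one _)
    _ = 1 := by
        rw [lintegral_indicator_one measurableSet_Ioc, Real.volume_Ioc, sub_sub_cancel]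
        have : ((n : ℝ≥0∞) + 1) = ENNReal.ofReal ((n : ℝ) + 1) := by
          rw [ENNReal.ofReal_add (by positivity) zero_le_one]
          simp
        rw [this, ← ENNReal.ofReal_mul (by positivity), mul_one_div_cancel (by positivity),
          ENNReal.ofReal_one]

/-- Monotonicity of `L` puts the window average between the values at the two ends `T o` and `T o -
d`, and the latter converges to the former by `tendsto_tsum_left`. -/
theorem tendsto_window (hLmono : MonotoneOn L (Ioi 0)) (hLcont : ContinuousOn L (Ioi 0))
    {T : ℕ → ℝ} {o : ℕ} (ho : ∀ j, T o ≤ T j) (ho0 : 0 < T o) :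
    Filter.Tendsto (fun n : ℕ => ((n : ℝ≥0∞) + 1) *
      ∫⁻ t in Ioi 0, (expNeg (∑' i, voidLoss L t t (T i)) -
        expNeg (∑' i, voidLoss L t (t + 1 / ((n : ℝ) + 1)) (T i)))) Filter.atTop
      (nhds (expNeg (∑' i, L (T o / T i)))) := by
  have hT : ∀ i, 0 < T i := fun i => ho0.trans_le (ho i)
  have hup := (continuous_expNeg.tendsto _).comp (tendsto_tsum_left hLmono hLcont hT ho0)
  have hanti : ∀ s t, 0 < s → s ≤ t →
      expNeg (∑' i, L (t / T i)) ≤ expNeg (∑' i, L (s / T i)) := fun s t hs hst =>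
    expNeg_antitone (ENNReal.tsum_le_tsum fun i => hLmono (div_pos hs (hT i))
      (div_pos (hs.trans_le hst) (hT i)) (div_le_div_of_nonneg_right hst (hT i).le))
  -- From then on the whole window lies in the positive half line.
  have hev : ∀ᶠ n : ℕ in Filter.atTop, 1 / ((n : ℝ) + 1) < T o / 2 :=
    tendsto_one_div_add_atTop_nhds_zero_nat.eventually_lt_const (by positivity)
  have hval : ∀ n : ℕ, ∀ x : ℝ≥0∞, ((n : ℝ≥0∞) + 1) *
      ∫⁻ _ in Ioc (T o - 1 / ((n : ℝ) + 1)) (T o), x = x := fun n x => by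
    have : ((n : ℝ≥0∞) + 1) = ENNReal.ofReal ((n : ℝ) + 1) := by
      rw [ENNReal.ofReal_add (by positivity) zero_le_one]
      simp
    rw [setLIntegral_const, Real.volume_Ioc, sub_sub_cancel, mul_left_comm, this,
      ← ENNReal.ofReal_mul (by positivity), mul_one_div_cancel (by positivity),
      ENNReal.ofReal_one, mul_one]
  have heq : ∀ n : ℕ, 1 / ((n : ℝ) + 1) < T o / 2 →
      ∫⁻ t in Ioi 0, (expNeg (∑' i, voidLoss L t t (T i)) -
        expNeg (∑' i, voidLoss L t (t + 1 / ((n : ℝ) + 1)) (T i))) =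
      ∫⁻ t in Ioc (T o - 1 / ((n : ℝ) + 1)) (T o), expNeg (∑' i, L (t / T i)) := fun n hn => by
    have hd : 0 < 1 / ((n : ℝ) + 1) := by positivity
    simp only [window_eq ho hd]
    rw [setLIntegral_indicator measurableSet_Ioc, inter_eq_left.2]
    exact fun t ht => lt_trans (by linarith) ht.1
  refine tendsto_of_tendsto_of_tendsto_of_le_of_le' tendsto_const_nhds hup ?_ ?_
  · filter_upwards [hev] with n hn
    rw [heq n hn]
    refine (hval n _).symm.le.trans ?_
    refine mul_le_mul' le_rfl ?_
    refine setLIntegral_mono' measurableSet_Ioc fun t ht => hanti _ _ ?_ ht.2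
    linarith [ht.1]
  · filter_upwards [hev] with n hn
    rw [heq n hn]
    refine le_trans ?_ (hval n _).le
    refine mul_le_mul' le_rfl ?_
    refine setLIntegral_mono' measurableSet_Ioc fun t ht => ?_
    simp only [Function.comp_apply, min_eq_right hn.le]
    exact hanti _ _ (by linarith) ht.1.le

variable [MeasurableSpace Ω] {μ : Measure Ω} [IsProbabilityMeasure μ]

include hC in
/-- The Laplace functional of a rate one Poisson process on the half line, for a loss that is
measured relative to the first point. -/
theorem lintegral_expNeg_first (hL : Measurable L) (hLmono : MonotoneOn L (Ioi 0))
    (hLcont : ContinuousOn L (Ioi 0)) (hc : 0 ≤ c) {T : ℕ → Ω → ℝ} (hT : ∀ i, Measurable (T i))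
    (hlap : ∀ f : ℝ → ℝ≥0∞, Measurable f →
      ∫⁻ ω, expNeg (∑' i, f (T i ω)) ∂μ = expNeg (∫⁻ t in Ioi 0, (1 - expNeg (f t))))
    {o : Ω → ℕ} (ho : ∀ᵐ ω ∂μ, ∀ j, T (o ω) ω ≤ T j ω) (ho0 : ∀ᵐ ω ∂μ, 0 < T (o ω) ω) :
    ∫⁻ ω, expNeg (∑' i, L (T (o ω) ω / T i ω)) ∂μ =
      expNeg (L 1) * ENNReal.ofReal (1 / (1 + c)) := by
  have hjoint : ∀ d : ℝ, Measurable fun p : ℝ × Ω =>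
      expNeg (∑' i, voidLoss L p.1 (p.1 + d) (T i p.2)) := fun d => by
    refine measurable_expNeg.comp (Measurable.tsum fun i => ?_)
    exact Measurable.ite (measurableSet_lt ((hT i).comp measurable_snd)
      (measurable_fst.add_const d)) measurable_const
      (hL.comp (measurable_fst.div ((hT i).comp measurable_snd)))
  have hjoint0 : Measurable fun p : ℝ × Ω =>
      expNeg (∑' i, voidLoss L p.1 p.1 (T i p.2)) := by simpa using hjoint 0
  set D : ℕ → ℝ → Ω → ℝ≥0∞ := fun n t ω => expNeg (∑' i, voidLoss L t t (T i ω)) -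
    expNeg (∑' i, voidLoss L t (t + 1 / ((n : ℝ) + 1)) (T i ω)) with hD
  have hDm : ∀ n, Measurable fun p : ℝ × Ω => D n p.1 p.2 := fun n => hjoint0.sub (hjoint _)
  set F : ℕ → Ω → ℝ≥0∞ := fun n ω => ((n : ℝ≥0∞) + 1) * ∫⁻ t in Ioi 0, D n t ω with hF
  have hleft : Filter.Tendsto (fun n => ∫⁻ ω, F n ω ∂μ) Filter.atTop
      (nhds (∫⁻ ω, expNeg (∑' i, L (T (o ω) ω / T i ω)) ∂μ)) := by
    refine tendsto_lintegral_of_dominated_convergence (fun _ => 1) (fun n => ?_)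
      (fun n => ?_) (by simp) ?_
    · exact (Measurable.lintegral_prod_left' (hDm n)).const_mul _
    · filter_upwards [ho] with ω hω
      exact window_le_one hω n
    · filter_upwards [ho, ho0] with ω hω hω0
      exact tendsto_window hLmono hLcont hω hω0
  -- Both terms of `D` are Laplace functionals, whose exponents differ by the window integral only;
  -- the common factor is exponential in `t` by scaling.
  have hmean : ∀ n : ℕ, ∀ t ∈ Ioi (0 : ℝ), ∫⁻ ω, D n t ω ∂μ =
      expNeg (ENNReal.ofReal ((1 + c) * t)) *
        (1 - expNeg (∫⁻ s in Ico t (t + 1 / ((n : ℝ) + 1)), expNeg (L (t / s)))) := by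
    intro n t ht
    have hd : 0 < 1 / ((n : ℝ) + 1) := by positivity
    have hm1 : Measurable fun ω => expNeg (∑' i, voidLoss L t (t + 1 / ((n : ℝ) + 1)) (T i ω)) :=
      (hjoint (1 / ((n : ℝ) + 1))).comp measurable_prodMk_left
    rw [hD, lintegral_sub hm1, hlap _ (measurable_voidLoss hL _ _),
      hlap _ (measurable_voidLoss hL _ _), lintegral_voidLoss_add hL ht hd, expNeg_add,
      lintegral_voidLoss_self hC hL hc ht, ENNReal.mul_sub fun _ _ => expNeg_ne_top _, mul_one]
    · rw [hlap _ (measurable_voidLoss hL _ _)]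
      exact expNeg_ne_top _
    · refine Filter.Eventually.of_forall fun ω => expNeg_antitone
        (ENNReal.tsum_le_tsum fun i => ?_)
      unfold voidLoss
      split_ifs with h1 h2 h2
      · exact le_rfl
      · exact absurd (h1.trans (by linarith)) h2
      · exact le_top
      · exact le_rfl
  have hright : Filter.Tendsto (fun n => ∫⁻ ω, F n ω ∂μ) Filter.atTop
      (nhds (expNeg (L 1) * ENNReal.ofReal (1 / (1 + c)))) := by
    have h1 : ∀ n, ∫⁻ ω, F n ω ∂μ = ∫⁻ t in Ioi 0, expNeg (ENNReal.ofReal ((1 + c) * t)) *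
        (((n : ℝ≥0∞) + 1) *
        (1 - expNeg (∫⁻ s in Ico t (t + 1 / ((n : ℝ) + 1)), expNeg (L (t / s))))) := fun n => by
      simp only [hF]
      rw [lintegral_const_mul' _ _ (by simp), ← lintegral_lintegral_swap (hDm n).aemeasurable,
        setLIntegral_congr_fun measurableSet_Ioi (hmean n), ← lintegral_const_mul' _ _ (by simp)]
      simp only [mul_left_comm]
    have h2 : expNeg (L 1) * ENNReal.ofReal (1 / (1 + c)) =
        ∫⁻ t in Ioi 0, expNeg (ENNReal.ofReal ((1 + c) * t)) * expNeg (L 1) := by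
      rw [lintegral_mul_const' _ _ (expNeg_ne_top _), lintegral_expNeg_mul (by linarith), mul_comm]
    simp only [h1, h2]
    refine tendsto_lintegral_of_dominated_convergence'
      (fun t => expNeg (ENNReal.ofReal ((1 + c) * t))) (fun n => ?_) (fun n => ?_) ?_ ?_
    -- Measurability in `t` is inherited from the left side of `hmean`, by Fubini.
    · refine AEMeasurable.congr
        (f := fun t => ((n : ℝ≥0∞) + 1) * ∫⁻ ω, D n t ω ∂μ) ?_ ?_
      · exact ((Measurable.lintegral_prod_right' (hDm n)).const_mul _).aemeasurable
      · refine (ae_restrict_iff' measurableSet_Ioi).2 (Filter.Eventually.of_forall fun t ht => ?_)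
        simp only [hmean n t ht]
        rw [mul_left_comm]
    · refine Filter.Eventually.of_forall fun t => mul_le_of_le_one_right' ?_
      calc _ ≤ ((n : ℝ≥0∞) + 1) * ∫⁻ s in Ico t (t + 1 / ((n : ℝ) + 1)), 1 := by
            gcongr
            exact (one_sub_expNeg_le _).trans (lintegral_mono fun s => expNeg_le_one _)
        _ = 1 := by
            have : ((n : ℝ≥0∞) + 1) = ENNReal.ofReal ((n : ℝ) + 1) := by
              rw [ENNReal.ofReal_add (by positivity) zero_le_one]
              simp
            rw [setLIntegral_one, Real.volume_Ico, add_sub_cancel_left, this,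
              ← ENNReal.ofReal_mul (by positivity), mul_one_div_cancel (by positivity),
              ENNReal.ofReal_one]
    · rw [lintegral_expNeg_mul (by linarith)]
      exact ENNReal.ofReal_ne_top
    · refine (ae_restrict_iff' measurableSet_Ioi).2 (Filter.Eventually.of_forall fun t ht => ?_)
      exact ENNReal.Tendsto.const_mul (tendsto_window_rate hLmono hLcont ht)
        (Or.inr (expNeg_ne_top _))
  exact tendsto_nhds_unique hleft hright

end FirstPoint

/-! ### The loss due to a thinned, Rayleigh faded interferer -/

/-- Laplace transform `E exp (-w b h)` of a thinned fading gain: `h` is exponential of mean one and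
`b` is an independent indicator of mean `p`. -/
noncomputable def thinnedLaplace (p w : ℝ) : ℝ := 1 - p * (w / (1 + w))

/-- The loss caused by an interferer at distance ratio `u ^ (-1/2)`. -/
noncomputable def interfererLoss (p th al u : ℝ) : ℝ≥0∞ :=
  ENNReal.ofReal (-Real.log (thinnedLaplace p (th * u ^ (al / 2))))

theorem thinnedLaplace_pos {p w : ℝ} (hp1 : p ≤ 1) (hw : 0 ≤ w) :
    0 < thinnedLaplace p w := by
  have h1 : w / (1 + w) < 1 := (div_lt_one (by linarith)).2 (by linarith)
  have h0 : 0 ≤ w / (1 + w) := by positivity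
  unfold thinnedLaplace
  nlinarith

theorem thinnedLaplace_le_one {p w : ℝ} (hp : 0 ≤ p) (hw : 0 ≤ w) :
    thinnedLaplace p w ≤ 1 := by
  have h0 : 0 ≤ p * (w / (1 + w)) := by positivity
  unfold thinnedLaplace
  linarith

theorem thinnedLaplace_antitone {p v w : ℝ} (hp : 0 ≤ p) (hv : 0 ≤ v) (hvw : v ≤ w) :
    thinnedLaplace p w ≤ thinnedLaplace p v := by
  have h0 : v / (1 + v) ≤ w / (1 + w) := by
    rw [div_le_div_iff₀ (by linarith) (by linarith)]
    nlinarith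
  unfold thinnedLaplace
  have := mul_le_mul_of_nonneg_left h0 hp
  linarith

section

variable {p th al : ℝ} (hp : 0 ≤ p) (hp1 : p ≤ 1) (hth : 0 ≤ th)

include hp hp1 hth in
theorem expNeg_interfererLoss {u : ℝ} (hu : 0 ≤ u) :
    expNeg (interfererLoss p th al u) =
      ENNReal.ofReal (thinnedLaplace p (th * u ^ (al / 2))) := by
  have hw : 0 ≤ th * u ^ (al / 2) := by positivity
  exact expNeg_ofReal_neg_log (thinnedLaplace_pos hp1 hw) (thinnedLaplace_le_one hp hw)

theorem measurable_interfererLoss : Measurable (interfererLoss p th al) := by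
  unfold interfererLoss thinnedLaplace
  fun_prop

include hp hp1 hth in
theorem interfererLoss_monotoneOn (hal : 0 < al) :
    MonotoneOn (interfererLoss p th al) (Ioi 0) := by
  intro u hu v hv huv
  have hu : 0 < u := hu
  have hv : 0 < v := hv
  refine ENNReal.ofReal_le_ofReal (neg_le_neg (Real.log_le_log
    (thinnedLaplace_pos hp1 (by positivity)) (thinnedLaplace_antitone hp (by positivity) ?_)))
  gcongr

include hp1 hth in
theorem interfererLoss_continuousOn :
    ContinuousOn (interfererLoss p th al) (Ioi 0) := by
  intro u hu
  have hu : 0 < u := hu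
  have h1 : 1 + th * u ^ (al / 2) ≠ 0 := by positivity
  have h2 : 1 - p * (th * u ^ (al / 2) / (1 + th * u ^ (al / 2))) ≠ 0 :=
    (thinnedLaplace_pos hp1 (by positivity : 0 ≤ th * u ^ (al / 2))).ne'
  refine ContinuousAt.continuousWithinAt ?_
  have h3 : ContinuousAt (fun u : ℝ => u ^ (al / 2)) u :=
    Real.continuousAt_rpow_const _ _ (Or.inl hu.ne')
  unfold interfererLoss thinnedLaplace
  refine ENNReal.continuous_ofReal.continuousAt.comp (ContinuousAt.neg (ContinuousAt.log ?_ h2))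
  exact continuousAt_const.sub (continuousAt_const.mul
    ((continuousAt_const.mul h3).div (continuousAt_const.add (continuousAt_const.mul h3)) h1))

include hp hp1 hth in
theorem lintegral_interfererLoss (hal : 2 < al) :
    ∫⁻ s in Ioi 1, (1 - expNeg (interfererLoss p th al (1 / s))) =
      ENNReal.ofReal (p * laplaceExponent al th) := by
  have hal0 : 0 < al := by linarith
  -- The integrand of `laplaceExponent`, extended by zero so that the substitution `t = x ^ (-(al /
  -- 2))` on the half line applies; it exchanges `(1, ∞)` and `(0, 1)`.
  set g : ℝ → ℝ := (Ioo (0 : ℝ) 1).indicator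
    fun t => 2 / al * (t ^ (-(2 / al)) * (th * (1 + th * t)⁻¹)) with hg
  have hgint : IntegrableOn g (Ioi 0) := by
    refine Integrable.integrableOn ((integrable_indicator_iff measurableSet_Ioo).2 ?_)
    have := (intervalIntegrable_iff_integrableOn_Ioc_of_le zero_le_one).1
      (intervalIntegrable_laplaceExponent hal hth)
    exact (this.mono_set Ioo_subset_Ioc_self).const_mul _
  have hgval : ∫ t in Ioi (0 : ℝ), g t = laplaceExponent al th := by
    rw [hg, setIntegral_indicator measurableSet_Ioo, inter_eq_right.2 Ioo_subset_Ioi_self,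
      integral_const_mul, laplaceExponent, intervalIntegral.integral_of_le zero_le_one,
      integral_Ioc_eq_integral_Ioo]
  have hane : -(al / 2) ≠ 0 := by
    have : 0 < al / 2 := by positivity
    linarith
  have hgcomp := (integrableOn_Ioi_comp_rpow_iff g hane).2 hgint
  have hval := (integral_comp_rpow_Ioi g hane).trans hgval
  have hpt : ∀ x ∈ Ioi (0 : ℝ), (|-(al / 2)| * x ^ (-(al / 2) - 1)) • g (x ^ (-(al / 2))) =
      (Ioi (1 : ℝ)).indicator (fun x => th * x ^ (-(al / 2)) / (1 + th * x ^ (-(al / 2)))) x := by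
    intro x hx
    have hx : 0 < x := hx
    by_cases h1 : 1 < x
    · have h2 : x ^ (-(al / 2)) ∈ Ioo (0 : ℝ) 1 :=
        ⟨by positivity, Real.rpow_lt_one_of_one_lt_of_neg h1 (by linarith)⟩
      rw [hg, indicator_of_mem h2, indicator_of_mem (mem_Ioi.2 h1), ← Real.rpow_mul hx.le,
        abs_neg, abs_of_pos (by positivity : 0 < al / 2), smul_eq_mul]
      have e1 : -(al / 2) * -(2 / al) = 1 := by field_simp
      have e2 : x ^ (-(al / 2) - 1) = x ^ (-(al / 2)) / x := Real.rpow_sub_one hx.ne' _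
      rw [e1, e2, Real.rpow_one]
      have h3 : 1 + th * x ^ (-(al / 2)) ≠ 0 := by positivity
      generalize x ^ (-(al / 2)) = y at *
      field_simp
    · have h2 : x ^ (-(al / 2)) ∉ Ioo (0 : ℝ) 1 := fun h => by
        have := Real.one_le_rpow_of_pos_of_le_one_of_nonpos hx (not_lt.1 h1)
          (by linarith : -(al / 2) ≤ 0)
        exact absurd h.2 (not_lt.2 this)
      rw [hg, indicator_of_notMem h2, indicator_of_notMem (by simpa using h1), smul_zero]
  rw [setIntegral_congr_fun measurableSet_Ioi hpt, setIntegral_indicator measurableSet_Ioi,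
    inter_eq_right.2 (Ioi_subset_Ioi zero_le_one)] at hval
  have hint := hgcomp.congr_fun hpt measurableSet_Ioi
  rw [IntegrableOn, integrable_indicator_iff measurableSet_Ioi, IntegrableOn,
    Measure.restrict_restrict measurableSet_Ioi,
    inter_eq_left.2 (Ioi_subset_Ioi zero_le_one)] at hint
  rw [← hval, ← integral_const_mul, ofReal_integral_eq_lintegral_ofReal (hint.const_mul p)]
  · refine setLIntegral_congr_fun measurableSet_Ioi fun s hs => ?_
    have hs0 : 0 < s := one_pos.trans hs
    have e : (1 / s) ^ (al / 2) = s ^ (-(al / 2)) := by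
      rw [one_div, Real.inv_rpow hs0.le, Real.rpow_neg hs0.le]
    rw [expNeg_interfererLoss hp hp1 hth (by positivity), ← ENNReal.ofReal_one,
      ← ENNReal.ofReal_sub _ (thinnedLaplace_pos hp1 (by positivity)).le, thinnedLaplace, e,
      sub_sub_cancel]
  · refine (ae_restrict_iff' measurableSet_Ioi).2 (Filter.Eventually.of_forall fun s hs => ?_)
    have hs0 : 0 < s := one_pos.trans hs
    show 0 ≤ _
    positivity

end

/-! ### Exponential gains -/

theorem expMeasure_Ioi {r : ℝ} (hr : 0 ≤ r) :
    expMeasure 1 (Ioi r) = expNeg (ENNReal.ofReal r) := by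
  have := isProbabilityMeasure_expMeasure (r := 1) one_pos
  have h := cdf_expMeasure_eq (r := 1) one_pos r
  rw [cdf_eq_real, if_pos hr, one_mul] at h
  rw [← compl_Iic, prob_compl_eq_one_sub measurableSet_Iic, expNeg_ofReal hr,
    ← ofReal_measureReal, h, ← ENNReal.ofReal_one, ← ENNReal.ofReal_sub _ ?_, sub_sub_cancel]
  rw [sub_nonneg]
  exact Real.exp_le_one_iff.2 (by linarith)

theorem expMeasure_lt_ofReal (y : ℝ≥0∞) :
    expMeasure 1 {x | y < ENNReal.ofReal x} = expNeg y := by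
  rcases eq_or_ne y ⊤ with rfl | hy
  · simp
  · rw [← ENNReal.ofReal_toReal hy, ← expMeasure_Ioi ENNReal.toReal_nonneg]
    congr 1
    ext x
    exact ENNReal.ofReal_lt_ofReal_iff_of_nonneg ENNReal.toReal_nonneg

theorem lintegral_expNeg_expMeasure {w : ℝ} (hw : 0 ≤ w) :
    ∫⁻ x, expNeg (ENNReal.ofReal w * ENNReal.ofReal x) ∂(expMeasure 1) =
      ENNReal.ofReal (1 / (1 + w)) := by
  have hm : Measurable (gammaPDF 1 1) := (measurable_gammaPDFReal _ _).ennreal_ofReal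
  rw [expMeasure, gammaMeasure, lintegral_withDensity_eq_lintegral_mul _ hm (by fun_prop),
    ← lintegral_expNeg_mul (by linarith : 0 < 1 + w),
    ← lintegral_add_compl _ measurableSet_Iio (A := Iio (0 : ℝ)), compl_Iio,
    Measure.restrict_congr_set Ioi_ae_eq_Ici.symm]
  have hz : ∫⁻ x in Iio (0 : ℝ), (gammaPDF 1 1 *
      fun x => expNeg (ENNReal.ofReal w * ENNReal.ofReal x)) x = 0 := by
    rw [setLIntegral_congr_fun (g := fun _ => 0) measurableSet_Iio fun x hx => ?_]
    · simp
    · simp [gammaPDF_of_neg hx]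
  rw [hz, zero_add]
  refine setLIntegral_congr_fun measurableSet_Ioi fun x hx => ?_
  have hx : 0 < x := hx
  have e : ENNReal.ofReal ((1 + w) * x) = ENNReal.ofReal x + ENNReal.ofReal (w * x) := by
    rw [← ENNReal.ofReal_add hx.le (by positivity)]
    congr 1
    ring
  simp only [Pi.mul_apply]
  rw [gammaPDF_of_nonneg hx.le, e, expNeg_add, ENNReal.ofReal_mul hw, expNeg_ofReal hx.le]
  simp

/-! ### Independent marks -/

/-- The σ-algebra is a named parameter, because it is later taken to be the one generated by a
subfamily of the marks. -/
theorem measurable_tsum_ennreal {α : Type*} {m : MeasurableSpace α} {f : ℕ → α → ℝ≥0∞}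
    (hf : ∀ i, Measurable (f i)) : Measurable fun x => ∑' i, f i x := Measurable.tsum hf

section Marks

variable {Ω : Type*} [MeasurableSpace Ω] {μ : Measure Ω}

/-- Because `F o = 0`, the sum is measurable for the σ-algebra of the marks other than `o`. -/
theorem indepFun_tsum_of_iIndepFun {M : Type*} [MeasurableSpace M] {ξ : ℕ → Ω → M}
    (hξ : ∀ i, Measurable (ξ i)) (hind : iIndepFun ξ μ) (o : ℕ) {F : ℕ → M → ℝ≥0∞}
    (hF : ∀ i, Measurable (F i)) (hFo : F o = 0) :
    IndepFun (fun ω => ∑' i, F i (ξ i ω)) (ξ o) μ := by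
  have h := indep_iSup_of_disjoint (fun i => (hξ i).comap_le) hind
    (S := {o}ᶜ) (T := {o}) disjoint_compl_left
  refine indep_of_indep_of_le_right (indep_of_indep_of_le_left h ?_) ?_
  · rw [← measurable_iff_comap_le]
    refine measurable_tsum_ennreal (m := ⨆ i ∈ ({o}ᶜ : Set ℕ),
      MeasurableSpace.comap (ξ i) inferInstance) fun i => ?_
    by_cases hi : i = o
    · subst hi
      rw [hFo]
      exact measurable_const
    · exact (hF i).comp ((comap_measurable (ξ i)).mono
        (le_iSup₂_of_le (f := fun i (_ : i ∈ ({o}ᶜ : Set ℕ)) =>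
          MeasurableSpace.comap (ξ i) inferInstance) i hi le_rfl) le_rfl)
  · exact le_iSup₂_of_le (f := fun i (_ : i ∈ ({o} : Set ℕ)) =>
      MeasurableSpace.comap (ξ i) inferInstance) o rfl le_rfl

variable [IsProbabilityMeasure μ]

/-- Independence factorizes the finite products; the bound by one lets the number of factors tend to
infinity. -/
theorem lintegral_expNeg_tsum_of_iIndepFun {Y : ℕ → Ω → ℝ≥0∞} (hY : ∀ i, Measurable (Y i))
    (hind : iIndepFun Y μ) {l : ℕ → ℝ≥0∞} (hl : ∀ i, ∫⁻ ω, expNeg (Y i ω) ∂μ = expNeg (l i)) :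
    ∫⁻ ω, expNeg (∑' i, Y i ω) ∂μ = expNeg (∑' i, l i) := by
  have h1 : Filter.Tendsto (fun n => ∫⁻ ω, ∏ i ∈ Finset.range n, expNeg (Y i ω) ∂μ) Filter.atTop
      (nhds (∫⁻ ω, expNeg (∑' i, Y i ω) ∂μ)) := by
    refine tendsto_lintegral_of_dominated_convergence (fun _ => 1) (fun n => ?_)
      (fun n => Filter.Eventually.of_forall fun ω => ?_) (by simp)
      (Filter.Eventually.of_forall fun ω => tendsto_prod_expNeg _)
    · exact Finset.measurable_prod _ fun i _ => measurable_expNeg.comp (hY i)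
    · exact Finset.prod_le_one' fun i _ => expNeg_le_one _
  refine tendsto_nhds_unique h1 ((tendsto_prod_expNeg l).congr fun n => ?_)
  have hind' : iIndepFun (fun i ω => expNeg (Y i ω)) μ :=
    hind.comp (fun _ => expNeg) fun _ => measurable_expNeg
  rw [lintegral_prod_eq_prod_lintegral_of_indepFun _ _ hind' fun i => measurable_expNeg.comp (hY i)]
  exact Finset.prod_congr rfl fun i _ => (hl i).symm

variable {M : Type*} [MeasurableSpace M]

/-- Probability that a marked station is selected and has a gain above the interference. -/
theorem measure_gain_gt_interference {ξ : ℕ → Ω → ℝ × M}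
    (hξ : ∀ i, Measurable (ξ i)) (hind : iIndepFun ξ μ) {A : Set M} (hA : MeasurableSet A)
    (hlaw : ∀ i, μ.map (fun ω => (ξ i ω).1) = expMeasure 1)
    (hindep : ∀ i, IndepFun (fun ω => (ξ i ω).1) (fun ω => (ξ i ω).2) μ) {p : ℝ}
    (hp : 0 ≤ p) (hp1 : p ≤ 1) (hpA : ∀ i, μ {ω | (ξ i ω).2 ∈ A} = ENNReal.ofReal p)
    (o : ℕ) {w : ℕ → ℝ} (hw : ∀ i, 0 ≤ w i) :
    μ {ω | (ξ o ω).2 ∈ A ∧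
        ∑' i, (if i = o then 0 else ENNReal.ofReal (w i)) *
          A.indicator (fun _ => ENNReal.ofReal (ξ i ω).1) (ξ i ω).2 < ENNReal.ofReal (ξ o ω).1} =
      ENNReal.ofReal p * expNeg (∑' i, if i = o then 0 else
        ENNReal.ofReal (-Real.log (thinnedLaplace p (w i)))) := by
  have hgm : Measurable fun m : ℝ × M => A.indicator (fun _ => ENNReal.ofReal m.1) m.2 := by
    have : (fun m : ℝ × M => A.indicator (fun _ => ENNReal.ofReal m.1) m.2) =
        (Prod.snd ⁻¹' A).indicator fun m => ENNReal.ofReal m.1 := rfl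
    rw [this]
    exact Measurable.indicator (by fun_prop) (measurable_snd hA)
  have h1m : ∀ i, Measurable fun ω => (ξ i ω).1 := fun i => measurable_fst.comp (hξ i)
  have h2m : ∀ i, Measurable fun ω => (ξ i ω).2 := fun i => measurable_snd.comp (hξ i)
  have htail : ∀ y : ℝ≥0∞, μ {ω | (ξ o ω).2 ∈ A ∧ y < ENNReal.ofReal (ξ o ω).1} =
      ENNReal.ofReal p * expNeg y := fun y => by
    have hy : MeasurableSet {x : ℝ | y < ENNReal.ofReal x} :=
      measurableSet_lt measurable_const ENNReal.measurable_ofReal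
    have h := (hindep o).symm.measure_inter_preimage_eq_mul A _ hA hy
    rw [← Measure.map_apply (h1m o) hy, hlaw, expMeasure_lt_ofReal] at h
    rw [← hpA o]
    exact h
  -- On `A` the exponential gain contributes `p / (1 + w)`, off `A` the integrand is one and
  -- contributes `1 - p`; the sum is `1 - p w / (1 + w)`.
  have hlapl : ∀ i, ∫⁻ ω, expNeg (ENNReal.ofReal (w i) *
      A.indicator (fun _ => ENNReal.ofReal (ξ i ω).1) (ξ i ω).2) ∂μ =
      ENNReal.ofReal (thinnedLaplace p (w i)) := fun i => by
    have hAm : MeasurableSet {ω | (ξ i ω).2 ∈ A} := h2m i hA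
    have hAc : μ {ω | (ξ i ω).2 ∈ A}ᶜ = ENNReal.ofReal (1 - p) := by
      rw [prob_compl_eq_one_sub hAm, hpA, ENNReal.ofReal_sub _ hp, ENNReal.ofReal_one]
    rw [← lintegral_add_compl _ hAm]
    have e1 : ∫⁻ ω in {ω | (ξ i ω).2 ∈ A}, expNeg (ENNReal.ofReal (w i) *
        A.indicator (fun _ => ENNReal.ofReal (ξ i ω).1) (ξ i ω).2) ∂μ =
        ENNReal.ofReal (1 / (1 + w i)) * ENNReal.ofReal p := by
      have e2 : ∫⁻ ω in {ω | (ξ i ω).2 ∈ A}, expNeg (ENNReal.ofReal (w i) *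
          A.indicator (fun _ => ENNReal.ofReal (ξ i ω).1) (ξ i ω).2) ∂μ =
          ∫⁻ ω, ((fun x : ℝ => expNeg (ENNReal.ofReal (w i) * ENNReal.ofReal x)) ∘
            fun ω => (ξ i ω).1) ω * ((A.indicator 1) ∘ fun ω => (ξ i ω).2) ω ∂μ := by
        rw [← lintegral_indicator hAm]
        refine lintegral_congr fun ω => ?_
        by_cases h : (ξ i ω).2 ∈ A
        · simp [indicator, h]
        · simp [indicator, h]
      have hf : Measurable fun x : ℝ => expNeg (ENNReal.ofReal (w i) * ENNReal.ofReal x) := by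
        fun_prop
      have hg : Measurable (A.indicator 1 : M → ℝ≥0∞) := measurable_one.indicator hA
      rw [e2]
      refine (lintegral_mul_eq_lintegral_mul_lintegral_of_indepFun (hf.comp (h1m i))
        (hg.comp (h2m i)) ((hindep i).comp hf hg)).trans ?_
      congr 1
      · rw [← lintegral_expNeg_expMeasure (hw i), ← hlaw i, lintegral_map hf (h1m i)]
        rfl
      · rw [← hpA i, ← lintegral_indicator_one hAm]
        rfl
    have e3 : ∫⁻ ω in {ω | (ξ i ω).2 ∈ A}ᶜ, expNeg (ENNReal.ofReal (w i) *
        A.indicator (fun _ => ENNReal.ofReal (ξ i ω).1) (ξ i ω).2) ∂μ = ENNReal.ofReal (1 - p) := by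
      rw [← hAc, ← setLIntegral_one]
      refine setLIntegral_congr_fun hAm.compl fun ω h => ?_
      have h : (ξ i ω).2 ∉ A := h
      simp [indicator, h]
    have hwi := hw i
    rw [e1, e3, ← ENNReal.ofReal_mul (by positivity), ← ENNReal.ofReal_add (by positivity)
      (by linarith), thinnedLaplace]
    congr 1
    field_simp
    ring
  set F : ℕ → ℝ × M → ℝ≥0∞ := fun i m => (if i = o then 0 else ENNReal.ofReal (w i)) *
    A.indicator (fun _ => ENNReal.ofReal m.1) m.2 with hF
  have hFm : ∀ i, Measurable (F i) := fun i => hgm.const_mul _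
  have hFo : F o = 0 := by
    funext m
    simp [hF]
  have hJm : Measurable fun ω => ∑' i, F i (ξ i ω) := Measurable.tsum fun i => (hFm i).comp (hξ i)
  have hJ := indepFun_tsum_of_iIndepFun hξ hind o hFm hFo
  have hlapJ : ∫⁻ ω, expNeg (∑' i, F i (ξ i ω)) ∂μ = expNeg (∑' i, if i = o then 0 else
        ENNReal.ofReal (-Real.log (thinnedLaplace p (w i)))) := by
    refine lintegral_expNeg_tsum_of_iIndepFun (fun i => (hFm i).comp (hξ i)) (hind.comp F hFm)
      fun i => ?_
    by_cases hi : i = o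
    · simp [hF, hi]
    · simp only [hF, if_neg hi]
      refine (hlapl i).trans ?_
      rw [expNeg_ofReal_neg_log (thinnedLaplace_pos hp1 (hw i)) (thinnedLaplace_le_one hp (hw i))]
  have hS : MeasurableSet {z : ℝ≥0∞ × (ℝ × M) | z.2.2 ∈ A ∧ z.1 < ENNReal.ofReal z.2.1} :=
    ((measurable_snd.comp measurable_snd) hA).inter (measurableSet_lt measurable_fst (by fun_prop))
  -- The interference and the mark of `o` have a product law, so the mark of `o` is integrated out
  -- first, by `htail` at a fixed interference.
  have hmain : μ {ω | (ξ o ω).2 ∈ A ∧ ∑' i, F i (ξ i ω) < ENNReal.ofReal (ξ o ω).1} =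
      ∫⁻ ω, ENNReal.ofReal p * expNeg (∑' i, F i (ξ i ω)) ∂μ := by
    have h1 : μ {ω | (ξ o ω).2 ∈ A ∧ ∑' i, F i (ξ i ω) < ENNReal.ofReal (ξ o ω).1} =
        μ.map (fun ω => (∑' i, F i (ξ i ω), ξ o ω))
          {z : ℝ≥0∞ × (ℝ × M) | z.2.2 ∈ A ∧ z.1 < ENNReal.ofReal z.2.1} := by
      rw [Measure.map_apply (hJm.prodMk (hξ o)) hS]
      rfl
    have : IsProbabilityMeasure (μ.map (ξ o)) := Measure.isProbabilityMeasure_map (hξ o).aemeasurable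
    rw [h1, (indepFun_iff_map_prod_eq_prod_map_map hJm.aemeasurable (hξ o).aemeasurable).1 hJ,
      Measure.prod_apply hS, lintegral_map (measurable_measure_prodMk_left hS) hJm]
    refine lintegral_congr fun ω => ?_
    rw [← htail, Measure.map_apply (hξ o) (measurable_prodMk_left hS)]
    rfl
  rw [← hlapJ, ← lintegral_const_mul' _ _ ENNReal.ofReal_ne_top, ← hmain]

end Marks

/-! ### Measurability of random indices -/

theorem measurable_nat_sInf {α : Type*} [MeasurableSpace α] {S : α → Set ℕ}
    (hS : ∀ n, MeasurableSet {x | n ∈ S x}) : Measurable fun x => sInf (S x) := by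
  refine measurable_to_countable' fun n => ?_
  have h1 : MeasurableSet ({x | n ∈ S x} ∩ ⋂ m, ⋂ (_ : m < n), {x | m ∈ S x}ᶜ) :=
    (hS n).inter (MeasurableSet.iInter fun m => MeasurableSet.iInter fun _ => (hS m).compl)
  -- `sInf ∅ = 0`, so the value zero is also taken where `S x` is empty.
  have h2 : MeasurableSet ({_x : α | n = 0} ∩ ⋂ m, {x | m ∈ S x}ᶜ) :=
    (MeasurableSet.const _).inter (MeasurableSet.iInter fun m => (hS m).compl)
  refine (congrArg MeasurableSet (Set.ext fun x => ?_)).mp (h1.union h2)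
  simp only [mem_union, mem_inter_iff, mem_iInter, mem_compl_iff, mem_ofPred_eq, mem_preimage,
    mem_singleton_iff]
  constructor
  · rintro (⟨h, h'⟩ | ⟨rfl, h⟩)
    · refine le_antisymm (Nat.sInf_le h) ?_
      by_contra! hlt
      exact h' _ hlt (Nat.sInf_mem ⟨n, h⟩)
    · exact Nat.sInf_eq_zero.2 (Or.inr (Set.eq_empty_iff_forall_notMem.2 h))
  · intro h
    rcases Set.eq_empty_or_nonempty (S x) with he | hne
    · right
      rw [he, Nat.sInf_empty] at h
      exact ⟨h.symm, fun m => by simp [he]⟩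
    · left
      exact ⟨h ▸ Nat.sInf_mem hne, fun m hm => Nat.notMem_of_lt_sInf (h ▸ hm)⟩

theorem measurable_eval_comp {α M : Type*} [MeasurableSpace α] [MeasurableSpace M]
    {f : α → ℕ → M} {o : α → ℕ} (hf : Measurable f) (ho : Measurable o) :
    Measurable fun x => f x (o x) := by
  have h : Measurable fun z : ℕ × (ℕ → M) => z.2 z.1 :=
    measurable_from_prod_countable_right fun n => measurable_pi_apply n
  exact h.comp (ho.prodMk hf)

/-! ### Popularity law and success event as a set of configurations -/

namespace Params

variable (p : Params)

theorem sum_zipf (hJ : 0 < p.J) : ∑ j, p.zipf j = 1 := by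
  have : Nonempty (Fin p.J) := ⟨⟨0, hJ⟩⟩
  have h : 0 < ∑ m : Fin p.J, ((m : ℝ) + 1) ^ (-p.zipfExp) :=
    Finset.sum_pos (fun m _ => by positivity) Finset.univ_nonempty
  simp only [zipf, ← Finset.sum_div]
  exact div_self h.ne'

theorem zipf_nonneg (j : Fin p.J) : 0 ≤ p.zipf j := by
  unfold zipf
  positivity

theorem qHit_nonneg : 0 ≤ p.qHit :=
  Finset.sum_nonneg fun j _ => mul_nonneg (p.zipf_nonneg j) (p.cacheProb_nonneg j)

theorem solvesLoadEquation_iff (x : ℝ) : p.SolvesLoadEquation x ↔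
    laplaceExponent p.alphaA (2 ^ (x * (p.Q / ((1 - p.eta) * p.W * (p.Tth - p.T1)))) - 1) =
      (1 - p.eps) / ((1 - p.qHit) * p.eps) := by
  rw [SolvesLoadEquation, chiB, laplaceExponent_eq_gauss2F1 p.two_lt_alphaA, mul_div_assoc]

/-- Requests and caches for which the requested content is not cached. -/
def missSet : Set (Fin p.J × (Fin p.J → Bool)) := {m | m.2 m.1 = false}

theorem measurableSet_missSet : MeasurableSet p.missSet := p.missSet.toFinite.measurableSet

/-- The index of the strongest station of a configuration. -/
noncomputable def strongest (x : ℕ → Plane) : ℕ :=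
  sInf {i : ℕ | ∀ j, p.Pa * (p.beta * ‖x j‖ ^ (-p.alphaA)) ≤ p.Pa * (p.beta * ‖x i‖ ^ (-p.alphaA))}

theorem measurable_strongest : Measurable p.strongest := by
  refine measurable_nat_sInf fun n => ?_
  have : {x : ℕ → Plane | n ∈ {i : ℕ | ∀ j, p.Pa * (p.beta * ‖x j‖ ^ (-p.alphaA)) ≤
      p.Pa * (p.beta * ‖x i‖ ^ (-p.alphaA))}} =
      ⋂ j, {x : ℕ → Plane | p.Pa * (p.beta * ‖x j‖ ^ (-p.alphaA)) ≤
      p.Pa * (p.beta * ‖x n‖ ^ (-p.alphaA))} := by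
    ext x
    simp
  rw [this]
  exact MeasurableSet.iInter fun j => measurableSet_le (by fun_prop) (by fun_prop)

/-- Configurations of locations and marks for which the strongest station has not cached the
requested content and its gain exceeds `th` times the relative interference of the others. -/
def successSet (th : ℝ) :
    Set ((ℕ → Plane) × (ℕ → ℝ × (Fin p.J × (Fin p.J → Bool)))) :=
  {z | (z.2 (p.strongest z.1)).2 ∈ p.missSet ∧
    ∑' i, (if i = p.strongest z.1 then 0 else ENNReal.ofReal
        (th * (discMean p.lamS (z.1 (p.strongest z.1)) / discMean p.lamS (z.1 i)) ^ (p.alphaA / 2))) *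
      p.missSet.indicator (fun _ => ENNReal.ofReal (z.2 i).1) (z.2 i).2 <
      ENNReal.ofReal (z.2 (p.strongest z.1)).1}

theorem measurableSet_successSet (th : ℝ) : MeasurableSet (p.successSet th) := by
  have hs : Measurable fun z : (ℕ → Plane) × (ℕ → ℝ × (Fin p.J × (Fin p.J → Bool))) =>
      p.strongest z.1 := p.measurable_strongest.comp measurable_fst
  have hx := measurable_eval_comp (measurable_fst (α := ℕ → Plane)
    (β := ℕ → ℝ × (Fin p.J × (Fin p.J → Bool)))) hs
  have hm := measurable_eval_comp (measurable_snd (α := ℕ → Plane)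
    (β := ℕ → ℝ × (Fin p.J × (Fin p.J → Bool)))) hs
  have hgm : Measurable fun m : ℝ × (Fin p.J × (Fin p.J → Bool)) =>
      p.missSet.indicator (fun _ => ENNReal.ofReal m.1) m.2 := by
    have : (fun m : ℝ × (Fin p.J × (Fin p.J → Bool)) =>
        p.missSet.indicator (fun _ => ENNReal.ofReal m.1) m.2) =
        (Prod.snd ⁻¹' p.missSet).indicator fun m => ENNReal.ofReal m.1 := rfl
    rw [this]
    exact Measurable.indicator (by fun_prop) (measurable_snd p.measurableSet_missSet)
  refine ((measurable_snd.comp hm) p.measurableSet_missSet).inter (measurableSet_lt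
    (Measurable.tsum fun i => Measurable.mul (Measurable.ite ?_ measurable_const ?_) ?_)
    (measurable_fst.comp hm).ennreal_ofReal)
  · exact hs (measurableSet_singleton i) |>.congr (by ext z; simp [eq_comm])
  · refine Measurable.ennreal_ofReal (Measurable.const_mul (Measurable.pow_const ?_ _) _)
    exact ((measurable_discMean _).comp hx).div
      ((measurable_discMean _).comp ((measurable_pi_apply i).comp measurable_fst))
  · exact hgm.comp ((measurable_pi_apply i).comp measurable_snd)

end Params

/-! ### Almost sure properties of the network and the success probability -/

namespace Network

variable {Ω : Type*} [MeasurableSpace Ω] {μ : Measure Ω} {p : Params} (net : Network μ p)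

/-- Locations of the stations. -/
def sites (ω : Ω) : ℕ → Plane := fun i => net.sbs i ω

/-- Fading, request and cache of the stations. -/
def marks (ω : Ω) : ℕ → ℝ × (Fin p.J × (Fin p.J → Bool)) :=
  fun i => (net.fading i ω, net.request i ω, net.cache i ω)

theorem measurable_sites : Measurable net.sites :=
  measurable_pi_lambda _ fun i => net.sbs_hppp.measurable i

theorem measurable_mark (i : ℕ) : Measurable fun ω => net.marks ω i :=
  (net.measurable_fading i).prodMk ((net.measurable_request i).prodMk (net.measurable_cache i))

theorem measurable_marks : Measurable net.marks := measurable_pi_lambda _ net.measurable_mark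

theorem measurableSet_missEvent : MeasurableSet net.missEvent := by
  have h := measurable_eval_comp net.measurable_marks
    (p.measurable_strongest.comp net.measurable_sites)
  exact (measurable_snd.comp h) p.measurableSet_missSet

/-- The prefactor is common to all stations and disappears from comparisons and ratios of powers. -/
theorem meanPower_eq (i : ℕ) (ω : Ω) : net.meanPower i ω =
    p.Pa * p.beta * (p.lamS * Real.pi) ^ (p.alphaA / 2) *
      discMean p.lamS (net.sbs i ω) ^ (-(p.alphaA / 2)) := by
  have h0 := p.lamS_pos
  have hpi := Real.pi_pos
  have h1 : (p.lamS * Real.pi * ‖net.sbs i ω‖ ^ 2) ^ (-(p.alphaA / 2)) =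
      (p.lamS * Real.pi) ^ (-(p.alphaA / 2)) * (‖net.sbs i ω‖ ^ 2) ^ (-(p.alphaA / 2)) :=
    Real.mul_rpow (by positivity) (by positivity)
  rw [meanPower, discMean, h1, Real.rpow_neg (by positivity : 0 ≤ p.lamS * Real.pi),
    ← Real.rpow_natCast ‖net.sbs i ω‖, ← Real.rpow_mul (norm_nonneg _)]
  have e : ((2 : ℕ) : ℝ) * -(p.alphaA / 2) = -p.alphaA := by
    push_cast
    ring
  rw [e]
  have : (p.lamS * Real.pi) ^ (p.alphaA / 2) ≠ 0 := by positivity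
  field_simp

theorem meanPower_pos {i : ℕ} {ω : Ω} (h : 0 < discMean p.lamS (net.sbs i ω)) :
    0 < net.meanPower i ω := by
  have h0 := p.lamS_pos
  have h1 := p.Pa_pos
  have h2 := p.beta_pos
  rw [meanPower_eq]
  positivity

theorem meanPower_le_iff {i j : ℕ} {ω : Ω} (hi : 0 < discMean p.lamS (net.sbs i ω))
    (hj : 0 < discMean p.lamS (net.sbs j ω)) : net.meanPower j ω ≤ net.meanPower i ω ↔
      discMean p.lamS (net.sbs i ω) ≤ discMean p.lamS (net.sbs j ω) := by
  have h0 := p.lamS_pos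
  have h1 := p.Pa_pos
  have h2 := p.beta_pos
  have h3 := p.two_lt_alphaA
  rw [meanPower_eq, meanPower_eq, mul_le_mul_iff_right₀ (by positivity),
    Real.rpow_le_rpow_iff_of_neg hj hi (by linarith)]

theorem meanPower_div {i o : ℕ} {ω : Ω} (hi : 0 < discMean p.lamS (net.sbs i ω))
    (ho : 0 < discMean p.lamS (net.sbs o ω)) : net.meanPower i ω / net.meanPower o ω =
      (discMean p.lamS (net.sbs o ω) / discMean p.lamS (net.sbs i ω)) ^ (p.alphaA / 2) := by
  have h0 := p.lamS_pos
  have h1 := p.Pa_pos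
  have h2 := p.beta_pos
  have hc : p.Pa * p.beta * (p.lamS * Real.pi) ^ (p.alphaA / 2) ≠ 0 := by positivity
  rw [meanPower_eq, meanPower_eq, mul_div_mul_left _ _ hc, Real.rpow_neg hi.le, Real.rpow_neg ho.le,
    Real.div_rpow ho.le hi.le, inv_div_inv]

theorem measure_lt_fading (i : ℕ) {t : ℝ} (ht : 0 ≤ t) :
    μ {ω | t < net.fading i ω} = expNeg (ENNReal.ofReal t) := by
  rw [← expMeasure_Ioi ht, ← (net.fading_law i).map_eq,
    Measure.map_apply (net.measurable_fading i) measurableSet_Ioi]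
  rfl

variable [IsProbabilityMeasure μ]

theorem J_pos {Ω : Type*} [MeasurableSpace Ω] {μ : Measure Ω} [IsProbabilityMeasure μ] {p : Params}
    (net : Network μ p) : 0 < p.J := by
  obtain ⟨ω⟩ : Nonempty Ω := nonempty_of_isProbabilityMeasure μ
  exact (net.request 0 ω).pos

/-- Splitting by the requested content gives `∑ a_j (1 - q_j) = 1 - q_hit`. -/
theorem measure_miss (i : ℕ) : μ {ω | net.Miss i ω} = ENNReal.ofReal (1 - p.qHit) := by
  have hsplit : {ω | net.Miss i ω} =
      ⋃ j ∈ (Finset.univ : Finset (Fin p.J)),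
        (net.request i ⁻¹' {j} ∩ net.cache i ⁻¹' {c | c j = false}) := by
    ext ω
    simp [Miss]
  have hcm : ∀ j, MeasurableSet {c : Fin p.J → Bool | c j = false} := fun j =>
    (Set.toFinite _).measurableSet
  have hfalse : ∀ j, μ (net.cache i ⁻¹' {c | c j = false}) =
      ENNReal.ofReal (1 - p.cacheProb j) := fun j => by
    have h : net.cache i ⁻¹' {c | c j = false} = {ω | net.cache i ω j = true}ᶜ := by
      ext ω
      simp
    have hm : MeasurableSet {ω | net.cache i ω j = true} :=
      net.measurable_cache i (Set.toFinite {c : Fin p.J → Bool | c j = true}).measurableSet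
    rw [h, prob_compl_eq_one_sub hm, net.cache_law, ENNReal.ofReal_sub _ (p.cacheProb_nonneg j),
      ENNReal.ofReal_one]
  rw [hsplit, measure_biUnion_finset]
  · have hterm : ∀ j, μ (net.request i ⁻¹' {j} ∩ net.cache i ⁻¹' {c | c j = false}) =
        ENNReal.ofReal (p.zipf j * (1 - p.cacheProb j)) := fun j => by
      rw [(net.indep_request i).measure_inter_preimage_eq_mul _ _ (measurableSet_singleton j)
        (hcm j), hfalse, ENNReal.ofReal_mul (p.zipf_nonneg j), ← net.request_law i j]
      rfl
    simp only [hterm]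
    rw [← ENNReal.ofReal_sum_of_nonneg fun j _ => mul_nonneg (p.zipf_nonneg j)
      (sub_nonneg.2 (p.cacheProb_le_one j))]
    congr 1
    simp only [mul_sub, mul_one, Finset.sum_sub_distrib]
    rw [p.sum_zipf net.J_pos, Params.qHit]
  · intro a _ b _ hab
    exact Set.disjoint_left.2 fun ω h1 h2 => hab (h1.1.symm.trans h2.1)
  · exact fun j _ => (net.measurable_request i (measurableSet_singleton j)).inter
      (net.measurable_cache i (hcm j))

theorem ae_fading_pos : ∀ᵐ ω ∂μ, ∀ i, 0 < net.fading i ω := by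
  refine ae_all_iff.2 fun i => ?_
  have hm : MeasurableSet {ω | 0 < net.fading i ω} := net.measurable_fading i measurableSet_Ioi
  refine (prob_compl_eq_zero_iff hm).2 ?_
  rw [net.measure_lt_fading i le_rfl]
  simp

theorem lintegral_fading (i : ℕ) : ∫⁻ ω, ENNReal.ofReal (net.fading i ω) ∂μ = 1 := by
  rw [lintegral_eq_lintegral_meas_lt μ
    (net.ae_fading_pos.mono fun ω h => (h i).le) (net.measurable_fading i).aemeasurable,
    setLIntegral_congr_fun measurableSet_Ioi fun t ht => net.measure_lt_fading i (le_of_lt ht)]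
  simpa using lintegral_expNeg_mul (b := 1) one_pos

/-- By Campbell's formula the expected number of stations at the origin is zero. Such stations must
be excluded, since `0 ^ (-α) = 0` would give them zero power. -/
theorem ae_discMean_pos : ∀ᵐ ω ∂μ, ∀ i, 0 < discMean p.lamS (net.sbs i ω) := by
  have hm : Measurable ((Iic (0 : ℝ)).indicator (1 : ℝ → ℝ≥0∞)) :=
    measurable_one.indicator measurableSet_Iic
  have h := net.sbs_hppp.lintegral_tsum_discMean p.lamS_pos hm
  have h0 : ∫⁻ t in Ioi (0 : ℝ), (Iic (0 : ℝ)).indicator (1 : ℝ → ℝ≥0∞) t = 0 :=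
    (setLIntegral_congr_fun (g := fun _ => 0) measurableSet_Ioi fun t ht =>
      indicator_of_notMem (s := Iic (0 : ℝ)) (not_le.2 (mem_Ioi.1 ht)) _).trans lintegral_zero
  have hmT : Measurable fun ω =>
      ∑' i, (Iic (0 : ℝ)).indicator (1 : ℝ → ℝ≥0∞) (discMean p.lamS (net.sbs i ω)) :=
    Measurable.tsum fun i => hm.comp ((measurable_discMean _).comp (net.sbs_hppp.measurable i))
  rw [h0, lintegral_eq_zero_iff hmT] at h
  filter_upwards [h] with ω hω i
  by_contra! hneg
  have h1 := ENNReal.tsum_eq_zero.1 hω i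
  rw [indicator_of_mem (mem_Iic.2 hneg)] at h1
  exact one_ne_zero h1

theorem ae_finite_discMean_le :
    ∀ᵐ ω ∂μ, ∀ t : ℝ, {i | discMean p.lamS (net.sbs i ω) ≤ t}.Finite := by
  have hc : 0 < p.lamS * Real.pi := mul_pos p.lamS_pos Real.pi_pos
  have h : ∀ᵐ ω ∂μ, ∀ n : ℕ, pointCount net.sbs (Metric.ball 0 n) ω ≠ ⊤ :=
    ae_all_iff.2 fun n => net.sbs_hppp.ae_pointCount_ne_top p.lamS_pos.le measurableSet_ball
      Metric.isBounded_ball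
  filter_upwards [h] with ω hω t
  obtain ⟨n, hn⟩ := exists_nat_gt √(t / (p.lamS * Real.pi))
  refine (Set.encard_ne_top_iff.1 (hω n)).subset fun i hi => ?_
  have hi : p.lamS * Real.pi * ‖net.sbs i ω‖ ^ 2 ≤ t := hi
  show net.sbs i ω ∈ Metric.ball 0 (n : ℝ)
  rw [mem_ball_zero_iff]
  refine lt_of_le_of_lt (Real.le_sqrt_of_sq_le ?_) hn
  rw [le_div_iff₀ hc]
  linarith

/-- Only finitely many stations are at most as far as station `0`, so a nearest one exists; the set
in the definition of `serving` is then nonempty and contains its infimum. -/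
theorem ae_serving_le :
    ∀ᵐ ω ∂μ, ∀ j, discMean p.lamS (net.sbs (net.serving ω) ω) ≤ discMean p.lamS (net.sbs j ω) := by
  filter_upwards [net.ae_discMean_pos, net.ae_finite_discMean_le] with ω hpos hfin
  have hne : {i : ℕ | ∀ j, net.meanPower j ω ≤ net.meanPower i ω}.Nonempty := by
    obtain ⟨i, hi, hmin⟩ := Set.exists_min_image _ (fun i => discMean p.lamS (net.sbs i ω))
      (hfin (discMean p.lamS (net.sbs 0 ω))) ⟨0, mem_ofPred_eq.mpr le_rfl⟩
    refine ⟨i, fun j => (net.meanPower_le_iff (hpos i) (hpos j)).2 ?_⟩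
    by_cases hj : discMean p.lamS (net.sbs j ω) ≤ discMean p.lamS (net.sbs 0 ω)
    · exact hmin j hj
    · exact le_trans hi (not_le.1 hj).le
  exact fun j => (net.meanPower_le_iff (hpos _) (hpos j)).1 (Nat.sInf_mem hne j)

/-- The stations with `discMean > 1` contribute an expected sum proportional to `∫_1^∞ t ^ (-α/2)
dt`, finite because `α > 2`. Almost surely only finitely many others remain. -/
theorem ae_summable : ∀ᵐ ω ∂μ, Summable fun i => net.fading i ω * net.meanPower i ω := by
  have hal := p.two_lt_alphaA
  set f : ℝ → ℝ≥0∞ := (Ioi (1 : ℝ)).indicator fun t => ENNReal.ofReal (t ^ (-(p.alphaA / 2))) with hf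
  have hfm : Measurable f := Measurable.indicator (by fun_prop) measurableSet_Ioi
  have hT : ∀ i, Measurable fun ω => discMean p.lamS (net.sbs i ω) := fun i =>
    (measurable_discMean _).comp (net.sbs_hppp.measurable i)
  have hfT : ∀ i, Measurable fun ω => f (discMean p.lamS (net.sbs i ω)) := fun i =>
    hfm.comp (hT i)
  have hfin : ∫⁻ t in Ioi (0 : ℝ), f t ≠ ⊤ := by
    rw [hf, setLIntegral_indicator measurableSet_Ioi,
      inter_eq_left.2 (Ioi_subset_Ioi (zero_le_one' ℝ))]
    have := (integrableOn_Ioi_rpow_of_lt (by linarith : -(p.alphaA / 2) < -1) one_pos)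
    exact this.lintegral_lt_top.ne
  have hind : ∀ i, IndepFun (fun ω => ENNReal.ofReal (net.fading i ω))
      (fun ω => f (discMean p.lamS (net.sbs i ω))) μ := fun i => by
    exact (net.indep_sbs.comp (φ := fun x : ℕ → Plane => f (discMean p.lamS (x i)))
      (ψ := fun m : ℕ → ℝ × (Fin p.J × (Fin p.J → Bool)) => ENNReal.ofReal (m i).1)
      (hfm.comp ((measurable_discMean _).comp (measurable_pi_apply i)))
      (measurable_fst.comp (measurable_pi_apply i)).ennreal_ofReal).symm
  have hsum : ∫⁻ ω, ∑' i, ENNReal.ofReal (net.fading i ω) * f (discMean p.lamS (net.sbs i ω)) ∂μ =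
      ∫⁻ t in Ioi (0 : ℝ), f t := by
    rw [← net.sbs_hppp.lintegral_tsum_discMean p.lamS_pos hfm]
    refine (MeasureTheory.lintegral_tsum fun i =>
      ((net.measurable_fading i).ennreal_ofReal.mul (hfT i)).aemeasurable).trans (Eq.trans ?_
        (MeasureTheory.lintegral_tsum fun i => (hfT i).aemeasurable).symm)
    refine tsum_congr fun i => ?_
    refine (lintegral_mul_eq_lintegral_mul_lintegral_of_indepFun
      (net.measurable_fading i).ennreal_ofReal (hfT i) (hind i)).trans ?_
    rw [net.lintegral_fading, one_mul]
  have hae : ∀ᵐ ω ∂μ, ∑' i, ENNReal.ofReal (net.fading i ω) *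
      f (discMean p.lamS (net.sbs i ω)) < ⊤ := ae_lt_top (Measurable.tsum fun i =>
    (net.measurable_fading i).ennreal_ofReal.mul (hfT i)) (hsum ▸ hfin)
  filter_upwards [hae, net.ae_finite_discMean_le, net.ae_fading_pos, net.ae_discMean_pos]
    with ω h1 h2 h3 h4
  have h5 := ENNReal.summable_toReal h1.ne
  have h6 := h5.mul_left (p.Pa * p.beta * (p.lamS * Real.pi) ^ (p.alphaA / 2))
  refine (summable_congr_cofinite (Filter.eventually_cofinite.2 ?_)).1 h6
  refine (h2 1).subset fun i hi => ?_
  by_contra hc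
  have hc : 1 < discMean p.lamS (net.sbs i ω) := not_le.1 hc
  refine hi ?_
  have := h4 i
  simp only [hf]
  rw [indicator_of_mem (mem_Ioi.2 hc), ENNReal.toReal_mul, ENNReal.toReal_ofReal (h3 i).le,
    ENNReal.toReal_ofReal (by positivity), meanPower_eq]
  ring

/-- The second Borel-Cantelli lemma: the misses are independent, with the same positive probability.
-/
theorem ae_frequently_miss (hq : p.qHit < 1) : ∀ᵐ ω ∂μ, ∃ᶠ i in Filter.atTop, net.Miss i ω := by
  have hm : ∀ i, MeasurableSet {ω | net.Miss i ω} := fun i =>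
    (measurable_snd.comp (net.measurable_mark i)) p.measurableSet_missSet
  have hind : iIndepSet (fun i => {ω | net.Miss i ω}) μ := by
    rw [iIndepSet_iff_meas_biInter hm]
    intro s
    exact net.indep_marks.measure_inter_preimage_eq_mul s (sets := fun _ => Prod.snd ⁻¹' p.missSet)
      fun i _ => measurable_snd p.measurableSet_missSet
  have hsum : ∑' i, μ {ω | net.Miss i ω} = ⊤ := by
    simp only [net.measure_miss]
    exact ENNReal.tsum_const_eq_top_of_ne_zero (by simpa using hq)
  have h := measure_limsup_eq_one hm hind hsum
  have h' := (prob_compl_eq_zero_iff (MeasurableSet.measurableSet_limsup hm)).2 h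
  filter_upwards [compl_mem_ae_iff.2 h'] with ω hω
  rw [compl_compl] at hω
  exact (Filter.mem_limsup_iff_frequently_mem (s := fun i => {ω | net.Miss i ω})).1 hω

theorem ae_interference (hq : p.qHit < 1) :
    ∀ᵐ ω ∂μ, (Summable fun i => net.interferenceTerm i ω) ∧ 0 < net.interference ω := by
  filter_upwards [net.ae_summable, net.ae_frequently_miss hq, net.ae_fading_pos,
    net.ae_discMean_pos] with ω h1 h2 h3 h4
  have hpos : ∀ i, 0 < net.fading i ω * net.meanPower i ω := fun i =>
    mul_pos (h3 i) (net.meanPower_pos (h4 i))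
  have h0 : ∀ i, 0 ≤ net.interferenceTerm i ω := fun i => by
    unfold interferenceTerm
    split_ifs
    · exact (hpos i).le
    · exact le_rfl
  have hs : Summable fun i => net.interferenceTerm i ω := by
    refine Summable.of_nonneg_of_le h0 (fun i => ?_) h1
    unfold interferenceTerm
    split_ifs
    · exact le_rfl
    · exact (hpos i).le
  refine ⟨hs, ?_⟩
  obtain ⟨i, hi, hmiss⟩ := Filter.frequently_atTop.1 h2 (net.serving ω + 1)
  refine hs.tsum_pos h0 i ?_
  rw [interferenceTerm, if_pos ⟨by omega, hmiss⟩]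
  exact hpos i

/-- Probability that the serving station has a miss and exceeds the threshold `th`. -/
theorem measure_successSet {th : ℝ} (hq : p.qHit < 1) (hth : 0 ≤ th) :
    μ {ω | (net.sites ω, net.marks ω) ∈ p.successSet th} =
      ENNReal.ofReal ((1 - p.qHit) * (1 / (1 + (1 - p.qHit) * laplaceExponent p.alphaA th))) := by
  have hp : 0 ≤ 1 - p.qHit := by linarith
  have hp1 : 1 - p.qHit ≤ 1 := by linarith [p.qHit_nonneg]
  have hal := p.two_lt_alphaA
  have hS := p.measurableSet_successSet th
  have hc : 0 ≤ laplaceExponent p.alphaA th := by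
    have := (laplaceExponent_strictMonoOn hal).monotoneOn (mem_Ici.2 le_rfl) (mem_Ici.2 hth) hth
    rwa [laplaceExponent_zero] at this
  set L := interfererLoss (1 - p.qHit) th p.alphaA with hL
  have hL1 : expNeg (L 1) ≠ 0 := by
    rw [hL, expNeg_interfererLoss hp hp1 hth zero_le_one]
    have := thinnedLaplace_pos hp1 (by positivity : 0 ≤ th * (1 : ℝ) ^ (p.alphaA / 2))
    simpa using this
  have hfirst := lintegral_expNeg_first (μ := μ) (L := L)
    (lintegral_interfererLoss hp hp1 hth hal) measurable_interfererLoss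
    (interfererLoss_monotoneOn hp hp1 hth (by linarith)) (interfererLoss_continuousOn hp1 hth)
    (mul_nonneg hp hc) (T := fun i ω => discMean p.lamS (net.sbs i ω))
    (fun i => (measurable_discMean _).comp (net.sbs_hppp.measurable i))
    (fun f hf => net.sbs_hppp.laplace_discMean p.lamS_pos hf) (o := net.serving)
    net.ae_serving_le (net.ae_discMean_pos.mono fun ω h => h _)
  -- With the locations frozen at `ω` the serving index is a constant, and only the marks are
  -- random.
  have hcond : ∀ ω, μ {ω' | (net.sites ω, net.marks ω') ∈ p.successSet th} =
      ENNReal.ofReal (1 - p.qHit) * expNeg (∑' i, if i = net.serving ω then 0 else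
        L (discMean p.lamS (net.sbs (net.serving ω) ω) / discMean p.lamS (net.sbs i ω))) := by
    intro ω
    have hpos : ∀ x : Plane, 0 ≤ discMean p.lamS x := fun x => by
      have := p.lamS_pos
      have := Real.pi_pos
      unfold discMean
      positivity
    exact measure_gain_gt_interference (μ := μ) (ξ := fun i ω => net.marks ω i) net.measurable_mark
      net.indep_marks p.measurableSet_missSet (fun i => (net.fading_law i).map_eq)
      net.indep_fading hp hp1 net.measure_miss (net.serving ω)
      (w := fun i => th * (discMean p.lamS (net.sbs (net.serving ω) ω) /
        discMean p.lamS (net.sbs i ω)) ^ (p.alphaA / 2))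
      fun i => mul_nonneg hth (Real.rpow_nonneg (div_nonneg (hpos _) (hpos _)) _)
  have h1 : μ {ω | (net.sites ω, net.marks ω) ∈ p.successSet th} =
      ∫⁻ ω, μ {ω' | (net.sites ω, net.marks ω') ∈ p.successSet th} ∂μ := by
    have : IsProbabilityMeasure (μ.map net.marks) :=
      Measure.isProbabilityMeasure_map net.measurable_marks.aemeasurable
    have hmap := (indepFun_iff_map_prod_eq_prod_map_map net.measurable_sites.aemeasurable
      net.measurable_marks.aemeasurable).1 net.indep_sbs
    have h2 : μ {ω | (net.sites ω, net.marks ω) ∈ p.successSet th} =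
        μ.map (fun ω => (net.sites ω, net.marks ω)) (p.successSet th) := by
      rw [Measure.map_apply (net.measurable_sites.prodMk net.measurable_marks) hS]
      rfl
    rw [h2, hmap, Measure.prod_apply hS, lintegral_map (measurable_measure_prodMk_left hS)
      net.measurable_sites]
    refine lintegral_congr fun ω => ?_
    rw [Measure.map_apply net.measurable_marks (measurable_prodMk_left hS)]
    rfl
  -- The sum in `hfirst` includes the serving station itself, at ratio one. Its factor `expNeg (L
  -- 1)` is nonzero and cancels.
  have h2 : ∫⁻ ω, expNeg (∑' i, L (discMean p.lamS (net.sbs (net.serving ω) ω) /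
      discMean p.lamS (net.sbs i ω))) ∂μ = expNeg (L 1) * ∫⁻ ω, expNeg (∑' i,
        if i = net.serving ω then 0 else
        L (discMean p.lamS (net.sbs (net.serving ω) ω) / discMean p.lamS (net.sbs i ω))) ∂μ := by
    rw [← lintegral_const_mul' _ _ (expNeg_ne_top _)]
    refine lintegral_congr_ae ?_
    filter_upwards [net.ae_discMean_pos] with ω hω
    rw [ENNReal.tsum_eq_add_tsum_ite (net.serving ω), expNeg_add,
      div_self (hω (net.serving ω)).ne']
    congr! 3
    funext i
    split_ifs <;> rfl
  rw [h2, ENNReal.mul_right_inj hL1 (expNeg_ne_top _)] at hfirst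
  simp only [h1, hcond]
  rw [lintegral_const_mul' _ _ ENNReal.ofReal_ne_top, hfirst, ← ENNReal.ofReal_mul hp]

end Network

/-! ### Conditional success probability, maximum load and SCD probability -/

namespace Network

variable {Ω : Type*} [MeasurableSpace Ω] {μ : Measure Ω} {p : Params} (net : Network μ p)

/-- The location and mark events are independent of the load. -/
theorem measure_load_inter (k : Set ℕ)
    {S : Set ((ℕ → Plane) × (ℕ → ℝ × (Fin p.J × (Fin p.J → Bool))))} (hS : MeasurableSet S) :
    μ (net.load ⁻¹' k ∩ {ω | (net.sites ω, net.marks ω) ∈ S}) =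
      μ (net.load ⁻¹' k) * μ {ω | (net.sites ω, net.marks ω) ∈ S} :=
  net.indep_load.measure_inter_preimage_eq_mul k S (MeasurableSet.of_discrete) hS

theorem measure_load_inter_missEvent (k : Set ℕ) :
    μ (net.load ⁻¹' k ∩ net.missEvent) = μ (net.load ⁻¹' k) * μ net.missEvent := by
  have hm : MeasurableSet {z : (ℕ → Plane) × (ℕ → ℝ × (Fin p.J × (Fin p.J → Bool))) |
      (z.2 (p.strongest z.1)).2 ∈ p.missSet} :=
    (measurable_snd.comp (measurable_eval_comp measurable_snd
      (p.measurable_strongest.comp measurable_fst))) p.measurableSet_missSet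
  exact net.measure_load_inter k hm

theorem measure_load {k : ℕ} (hk : 1 ≤ k) :
    μ {ω | net.load ω = k} = ENNReal.ofReal (loadPMF (p.lamU / p.lamS) k) := by
  obtain ⟨n, rfl⟩ : ∃ n, k = n + 1 := ⟨k - 1, by omega⟩
  rw [net.load_law, lintegral_poisson_typicalCellAreaLaw p.lamU_pos p.lamS_pos]

theorem lt_accessRate_iff (hT : p.T1 < p.Tth) {ω : Ω} (hk : 1 ≤ net.load ω)
    (hI : 0 < net.interference ω) (hf : 0 < net.fading (net.serving ω) ω)
    (hM : 0 < net.meanPower (net.serving ω) ω) :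
    p.Q / (p.Tth - p.T1) < net.accessRate 0 ω ↔
      (2 ^ (net.load ω * (p.Q / ((1 - p.eta) * p.W * (p.Tth - p.T1)))) - 1) * net.interference ω <
        net.fading (net.serving ω) ω * net.meanPower (net.serving ω) ω := by
  have hk' : (0 : ℝ) < net.load ω := by exact_mod_cast hk
  have h1 : 0 < 1 - p.eta := sub_pos.2 p.eta_lt_one
  have h2 := p.W_pos
  have h3 : 0 < p.Tth - p.T1 := sub_pos.2 hT
  have hz : 0 < net.fading (net.serving ω) ω * net.meanPower (net.serving ω) ω
      / net.interference ω := by positivity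
  -- The target rate is written as a multiple of the factor in front of the logarithm, which then
  -- cancels.
  have e : p.Q / (p.Tth - p.T1) = (1 - p.eta) * p.W / net.load ω *
      (net.load ω * (p.Q / ((1 - p.eta) * p.W * (p.Tth - p.T1)))) := by
    field_simp
  rw [accessRate, add_zero, e, mul_lt_mul_iff_right₀ (by positivity),
    Real.lt_logb_iff_rpow_lt one_lt_two (by linarith), ← sub_lt_iff_lt_add', lt_div_iff₀ hI]

/-- Division by a zero load makes the rate zero, below the target. The case is needed because
`Network` does not exclude a zero load pointwise. -/
theorem condSCD_zero (hT : p.T1 < p.Tth) : net.condSCD 0 = 0 := by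
  have h3 : 0 < p.Tth - p.T1 := sub_pos.2 hT
  have hB : MeasurableSet (net.missEvent ∩ {ω | net.load ω = 0}) :=
    net.measurableSet_missEvent.inter (net.measurable_load (measurableSet_singleton 0))
  have hempty : net.missEvent ∩ {ω | net.load ω = 0} ∩
      {ω | p.Q / (p.Tth - p.T1) < net.accessRate 0 ω} = ∅ := by
    refine Set.eq_empty_iff_forall_notMem.2 fun ω hω => ?_
    have hl : net.load ω = 0 := hω.1.2
    have hr : p.Q / (p.Tth - p.T1) < net.accessRate 0 ω := hω.2
    rw [accessRate, hl, Nat.cast_zero, div_zero, zero_mul] at hr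
    exact absurd hr (not_lt.2 (div_nonneg p.Q_pos.le h3.le))
  rw [condSCD, measureReal_def, cond_apply hB, hempty]
  simp

variable [IsProbabilityMeasure μ]

/-- Membership in the success set, in terms of the interference. -/
theorem ae_mem_successSet_iff {th : ℝ} (hq : p.qHit < 1) (hth : 0 ≤ th) :
    ∀ᵐ ω ∂μ, (net.sites ω, net.marks ω) ∈ p.successSet th ↔ ω ∈ net.missEvent ∧
      th * net.interference ω <
        net.fading (net.serving ω) ω * net.meanPower (net.serving ω) ω := by
  filter_upwards [net.ae_interference hq, net.ae_fading_pos, net.ae_discMean_pos]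
    with ω hI hf hT
  have hs := hI.1
  have hMo := net.meanPower_pos (hT (net.serving ω))
  have hterm : ∀ i, (if i = net.serving ω then 0 else ENNReal.ofReal
        (th * (discMean p.lamS (net.sbs (net.serving ω) ω) /
          discMean p.lamS (net.sbs i ω)) ^ (p.alphaA / 2))) *
      p.missSet.indicator (fun _ => ENNReal.ofReal (net.fading i ω))
        (net.request i ω, net.cache i ω) =
      ENNReal.ofReal (th / net.meanPower (net.serving ω) ω * net.interferenceTerm i ω) := by
    intro i
    rw [← net.meanPower_div (hT i) (hT _), interferenceTerm]
    by_cases hi : i = net.serving ω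
    · rw [if_pos hi, if_neg fun h => h.1 hi]
      simp
    · rw [if_neg hi]
      by_cases hm : net.Miss i ω
      · have hm' : (net.request i ω, net.cache i ω) ∈ p.missSet := hm
        have := net.meanPower_pos (hT i)
        rw [indicator_of_mem hm', if_pos ⟨hi, hm⟩, ← ENNReal.ofReal_mul (by positivity)]
        congr 1
        ring
      · have hm' : (net.request i ω, net.cache i ω) ∉ p.missSet := hm
        rw [indicator_of_notMem hm', if_neg fun h => hm h.2]
        simp
  have h0 : ∀ i, 0 ≤ th / net.meanPower (net.serving ω) ω * net.interferenceTerm i ω := fun i => by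
    refine mul_nonneg (div_nonneg hth hMo.le) ?_
    unfold interferenceTerm
    split_ifs
    · exact mul_nonneg (hf i).le (net.meanPower_pos (hT i)).le
    · exact le_rfl
  have hsum : ∑' i, ENNReal.ofReal
      (th / net.meanPower (net.serving ω) ω * net.interferenceTerm i ω) =
      ENNReal.ofReal (th / net.meanPower (net.serving ω) ω * net.interference ω) := by
    rw [← ENNReal.ofReal_tsum_of_nonneg h0 (hs.mul_left _), tsum_mul_left]
    rfl
  have hlt : ENNReal.ofReal (th / net.meanPower (net.serving ω) ω * net.interference ω) <
      ENNReal.ofReal (net.fading (net.serving ω) ω) ↔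
      th * net.interference ω <
        net.fading (net.serving ω) ω * net.meanPower (net.serving ω) ω := by
    rw [ENNReal.ofReal_lt_ofReal_iff (hf _), div_mul_eq_mul_div, div_lt_iff₀ hMo]
  rw [← hlt, ← hsum, ← tsum_congr hterm]
  rfl

/-- The serving index is random, so `measure_miss` does not apply directly. At threshold zero the
condition on the gain holds almost surely, and the success event reduces to the miss. -/
theorem measure_missEvent (hq : p.qHit < 1) : μ net.missEvent = ENNReal.ofReal (1 - p.qHit) := by
  have h := net.measure_successSet hq le_rfl
  rw [laplaceExponent_zero, mul_zero, add_zero, div_one, mul_one] at h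
  rw [← h]
  refine measure_congr ?_
  filter_upwards [net.ae_mem_successSet_iff hq le_rfl, net.ae_fading_pos, net.ae_discMean_pos]
    with ω hω hf hT
  refine propext (Iff.trans ?_ hω.symm)
  rw [zero_mul]
  exact ⟨fun h => ⟨h, mul_pos (hf _) (net.meanPower_pos (hT _))⟩, fun h => h.1⟩

/-- Conditional success probability at load `k`. -/
theorem condSCD_eq (hq : p.qHit < 1) (hT : p.T1 < p.Tth) {k : ℕ} (hk : 1 ≤ k) :
    net.condSCD k = 1 / (1 + (1 - p.qHit) * laplaceExponent p.alphaA
      (2 ^ (k * (p.Q / ((1 - p.eta) * p.W * (p.Tth - p.T1)))) - 1)) := by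
  set th : ℝ := 2 ^ (k * (p.Q / ((1 - p.eta) * p.W * (p.Tth - p.T1)))) - 1 with hth
  have h1 : 0 < 1 - p.eta := sub_pos.2 p.eta_lt_one
  have h2 := p.W_pos
  have h3 : 0 < p.Tth - p.T1 := sub_pos.2 hT
  have h4 := p.Q_pos
  have hth0 : 0 ≤ th := sub_nonneg.2 (Real.one_le_rpow one_le_two (by positivity))
  have hp : 0 < 1 - p.qHit := by linarith
  have hload : 0 < loadPMF (p.lamU / p.lamS) k :=
    loadPMF_pos (div_pos p.lamU_pos p.lamS_pos) k
  have hc : 0 ≤ laplaceExponent p.alphaA th := by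
    have := (laplaceExponent_strictMonoOn p.two_lt_alphaA).monotoneOn (mem_Ici.2 le_rfl)
      (mem_Ici.2 hth0) hth0
    rwa [laplaceExponent_zero] at this
  have hB : MeasurableSet (net.missEvent ∩ {ω | net.load ω = k}) :=
    net.measurableSet_missEvent.inter (net.measurable_load (measurableSet_singleton k))
  have hBm : μ (net.missEvent ∩ {ω | net.load ω = k}) =
      ENNReal.ofReal (loadPMF (p.lamU / p.lamS) k * (1 - p.qHit)) := by
    rw [inter_comm, ENNReal.ofReal_mul hload.le, ← net.measure_missEvent hq, ← net.measure_load hk]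
    exact net.measure_load_inter_missEvent {k}
  have hBS : μ (net.missEvent ∩ {ω | net.load ω = k} ∩
      {ω | p.Q / (p.Tth - p.T1) < net.accessRate 0 ω}) =
      ENNReal.ofReal (loadPMF (p.lamU / p.lamS) k *
        ((1 - p.qHit) * (1 / (1 + (1 - p.qHit) * laplaceExponent p.alphaA th)))) := by
    rw [ENNReal.ofReal_mul hload.le, ← net.measure_load hk, ← net.measure_successSet hq hth0]
    refine Eq.trans (measure_congr ?_)
      (net.measure_load_inter {k} (p.measurableSet_successSet th))
    filter_upwards [net.ae_mem_successSet_iff hq hth0, net.ae_interference hq, net.ae_fading_pos,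
      net.ae_discMean_pos] with ω hω hI hf hT'
    refine propext ?_
    have key := fun hl : net.load ω = k => net.lt_accessRate_iff hT (by omega) hI.2 (hf _)
      (net.meanPower_pos (hT' (net.serving ω)))
    constructor
    · rintro ⟨⟨hmiss, hl⟩, hr⟩
      have hl : net.load ω = k := hl
      have := (key hl).1 hr
      rw [hl] at this
      exact ⟨hl, hω.2 ⟨hmiss, this⟩⟩
    · rintro ⟨hl, hs⟩
      have hl : net.load ω = k := hl
      obtain ⟨hmiss, hlt⟩ := hω.1 hs
      refine ⟨⟨hmiss, hl⟩, (key hl).2 ?_⟩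
      rw [hl]
      exact hlt
  rw [condSCD, measureReal_def, cond_apply hB, hBm, hBS, ENNReal.toReal_mul, ENNReal.toReal_inv,
    ENNReal.toReal_ofReal (by positivity), ENNReal.toReal_ofReal (by positivity)]
  field_simp

theorem exists_maxLoad (hq : p.qHit < 1) (hT : p.T1 < p.Tth) :
    ∃ kappa : ℝ, 0 < kappa ∧ (∀ x : ℝ, p.SolvesLoadEquation x ↔ x = kappa) ∧
      net.maxLoad = ⌊kappa⌋₊ ∧ net.admissibleLoads = Set.Icc 1 net.maxLoad := by
  have h1 : 0 < 1 - p.eta := sub_pos.2 p.eta_lt_one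
  have h2 := p.W_pos
  have h3 : 0 < p.Tth - p.T1 := sub_pos.2 hT
  have h4 := p.Q_pos
  have h5 := p.eps_pos
  have h6 : 0 < 1 - p.eps := sub_pos.2 p.eps_lt_one
  have hp : 0 < 1 - p.qHit := by linarith
  obtain ⟨kappa, hk0, hsol, hle⟩ := exists_unique_load p.two_lt_alphaA
    (c := p.Q / ((1 - p.eta) * p.W * (p.Tth - p.T1))) (by positivity)
    (D := (1 - p.eps) / ((1 - p.qHit) * p.eps)) (by positivity)
  have hadm : net.admissibleLoads = Set.Icc 1 ⌊kappa⌋₊ := by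
    ext k
    refine and_congr_right fun hk => ?_
    rw [Nat.le_floor_iff hk0.le, ← hle k (Nat.cast_nonneg k), net.condSCD_eq hq hT hk]
    have hth0 : (0 : ℝ) ≤ 2 ^ (k * (p.Q / ((1 - p.eta) * p.W * (p.Tth - p.T1)))) - 1 :=
      sub_nonneg.2 (Real.one_le_rpow one_le_two (by positivity))
    have hc := (laplaceExponent_strictMonoOn p.two_lt_alphaA).monotoneOn (mem_Ici.2 le_rfl)
      (mem_Ici.2 hth0) hth0
    rw [laplaceExponent_zero] at hc
    -- Once denominators are cleared, both sides are the same inequality, linear in the Laplace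
    -- exponent.
    rw [le_div_iff₀ (by positivity), le_div_iff₀ (by positivity)]
    constructor <;> intro h <;> linarith
  have hmax : net.maxLoad = ⌊kappa⌋₊ := by
    rw [maxLoad, hadm]
    -- If the floor is zero no load is admissible, and `sSup ∅ = 0` agrees with it.
    rcases Nat.eq_zero_or_pos ⌊kappa⌋₊ with h0 | h0
    · rw [h0]
      simp
    · exact csSup_Icc h0
  exact ⟨kappa, hk0, fun x => (p.solvesLoadEquation_iff x).trans (hsol x), hmax, hmax ▸ hadm⟩

theorem scdProb_eq (hq : p.qHit < 1) (hT : p.T1 < p.Tth) :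
    net.scdProb = ∑ k ∈ Finset.Icc 1 net.maxLoad, loadPMF (p.lamU / p.lamS) k := by
  obtain ⟨-, -, -, -, hadm⟩ := net.exists_maxLoad hq hT
  have hp : 0 < 1 - p.qHit := by linarith
  have hset : {ω | p.eps ≤ net.condSCD (net.load ω)} =
      net.load ⁻¹' (Finset.Icc 1 net.maxLoad : Finset ℕ) := by
    ext ω
    rw [mem_preimage, Finset.coe_Icc, ← hadm]
    refine ⟨fun h => ⟨?_, h⟩, fun h => h.2⟩
    by_contra hc
    have h0 : net.load ω = 0 := by omega
    have h : p.eps ≤ net.condSCD (net.load ω) := h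
    rw [h0, net.condSCD_zero hT] at h
    exact absurd h (not_le.2 p.eps_pos)
  have hsum : μ (net.load ⁻¹' (Finset.Icc 1 net.maxLoad : Finset ℕ)) =
      ENNReal.ofReal (∑ k ∈ Finset.Icc 1 net.maxLoad, loadPMF (p.lamU / p.lamS) k) := by
    rw [← sum_measure_preimage_singleton _ fun k _ =>
      net.measurable_load (measurableSet_singleton k), ENNReal.ofReal_sum_of_nonneg fun k _ =>
        (loadPMF_pos (div_pos p.lamU_pos p.lamS_pos) k).le]
    exact Finset.sum_congr rfl fun k hk => net.measure_load (Finset.mem_Icc.1 hk).1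
  rw [scdProb, measureReal_def, cond_apply net.measurableSet_missEvent, hset, inter_comm,
    net.measure_load_inter_missEvent, net.measure_missEvent hq, mul_comm, mul_assoc,
    ENNReal.mul_inv_cancel (by simpa using hp) ENNReal.ofReal_ne_top, mul_one, hsum,
    ENNReal.toReal_ofReal]
  exact Finset.sum_nonneg fun k _ => (loadPMF_pos (div_pos p.lamU_pos p.lamS_pos) k).le

end Network

end SelfBackhaul

theorem theorem2 {Ω : Type*} [MeasurableSpace Ω] (μ : Measure Ω) [IsProbabilityMeasure μ]
    (p : Params) (net : Network μ p)
    -- non-cached contents occur, and the backhaul leaves time for the access link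
    (hq : p.qHit < 1) (hT : p.T1 < p.Tth) :
    -- the interference is a genuine (finite, positive) quantity
    (∀ᵐ ω ∂μ, (Summable fun i => net.interferenceTerm i ω) ∧ 0 < net.interference ω) ∧
    -- probability mass function of the load
    (∀ k : ℕ, 1 ≤ k → μ.real {ω | net.load ω = k} = loadPMF (p.lamU / p.lamS) k) ∧
    -- SCD probability
    net.scdProb = ∑ k ∈ Finset.Icc 1 net.maxLoad, loadPMF (p.lamU / p.lamS) k ∧
    -- the maximum load is the integer part of the unique solution of the equation, and the
    -- admissible loads are exactly the loads up to it
    (∃ κ : ℝ, 0 < κ ∧ (∀ x : ℝ, p.SolvesLoadEquation x ↔ x = κ) ∧ net.maxLoad = ⌊κ⌋₊ ∧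
      net.admissibleLoads = Set.Icc 1 net.maxLoad) ∧
    -- minimum SBS density
    (∀ rho : ℝ, 0 < rho →
      (loadPMF ((net.maxLoad : ℝ) + 1) (net.maxLoad + 1) ≤ rho →
        IsLeast (overloadFree p.lamU net.maxLoad rho) (p.lamU / ((net.maxLoad : ℝ) + 1))) ∧
      (1 ≤ net.maxLoad → rho < loadPMF ((net.maxLoad : ℝ) + 1) (net.maxLoad + 1) →
        ∃ m ∈ Set.Ioc 0 ((net.maxLoad : ℝ) * shape / (shape + 1)),
          loadPMF m (net.maxLoad + 1) = rho ∧
          (∀ m' ∈ Set.Ioc 0 ((net.maxLoad : ℝ) * shape / (shape + 1)),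
            loadPMF m' (net.maxLoad + 1) = rho → m' = m) ∧
          IsLeast (overloadFree p.lamU net.maxLoad rho) (p.lamU / m))) := by
  obtain ⟨kappa, hkappa⟩ := net.exists_maxLoad hq hT
  refine ⟨net.ae_interference hq, fun k hk => ?_, net.scdProb_eq hq hT, ⟨kappa, hkappa⟩,
    fun rho hrho => ⟨isLeast_overloadFree_of_le p.lamU_pos,
      exists_isLeast_overloadFree p.lamU_pos hrho⟩⟩
  rw [measureReal_def, net.measure_load hk, ENNReal.toReal_ofReal
    (loadPMF_pos (div_pos p.lamU_pos p.lamS_pos) k).le]
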